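/- Notation. $\mathbb H$ is the ring of proper real rational functions with all poles in the open left half-plane, $\mathbb J$ its group of units, $A(\infty)$ the value at infinity of a proper rational matrix $A$. A matrix over $\mathbb H$ is called unimodular if its determinant is in $\mathbb J$. A real rational matrix $K$ stabilizes $P$ if $I+PK$ is invertible and $(I+PK)^{-1}$, $(I+PK)^{-1}P$, $K(I+PK)^{-1}$, $(I+KP)^{-1}$ have entries in $\mathbb H$. A real rational Carathéodory function is a real rational $m\times m$ matrix function $F$ without poles in the closed unit disc such that $F(z)+F(z)^*>0$ for $|z|\le 1$. Setting. Let $N_0,N_1,D_0,D_1\in\mathbb H^{m\times m}$, $N_\lambda=\lambda N_1+(1-\lambda)N_0$, $D_\lambda=\lambda D_1+(1-\lambda)D_0$ with $\det D_\lambda\not\equiv 0$, and $P_\lambda=N_\lambda D_\lambda^{-1}$ for $\lambda\in[0,1]$. The simultaneous stabilization problem asks for a proper $m\times m$ real rational $K$ that stabilizes $P_\lambda$ for all $\lambda\in[0,1]$. Let $M=\begin{bmatrix}N_0&N_1\\D_0&D_1\end{bmatrix}$, suppose $\det M(\infty)\ne0$ and that the zeros of $\det M$ in the closed right half-plane are simple;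 let $s_1,\dots,s_t$ be these zeros, $z_i=(1-s_i)/(1+s_i)$, and write $\operatorname{Adj}(M)/\det M=\begin{bmatrix}m_{11}&m_{12}\\m_{21}&m_{22}\end{bmatrix}$. Let $M_i\in\mathbb C^{m\times m}$ satisfy $[\,I\;\;M_i\,]\operatorname{Adj}(M(s_i))=0$ (that is, $[\Delta_0(s_i)\;\Delta_1(s_i)]\operatorname{Adj}(M(s_i))=0$ whenever $\Delta_0(s_i)^{-1}\Delta_1(s_i)=M_i$), and let $M_i^{1/2}$ be a square root of $M_i$ with $M_i^{1/2}+(M_i^{1/2})^*>0$, for $i=1,\dots,t$. For a real rational $F$ set $F_1(s)=F\big(\tfrac{1-s}{1+s}\big)$. Proposition 3. (1) If $F$ is a real rational Carathéodory function with $F(z_i)=M_i^{1/2}$ for all $i$, then $N_c=m_{11}+F_1^2m_{21}$ and $D_c=m_{12}+F_1^2m_{22}$ lie in $\mathbb H^{m\times m}$, $N_cN_0+D_cD_0=I$, $N_cN_1+D_cD_1=F_1^2$, and $F_1^2$ is unimodular; if moreover $\det D_c(\infty)\neq0$, then $K=D_c^{-1}N_c=(m_{12}+F_1^2m_{22})^{-1}(m_{11}+F_1^2m_{21})$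 solves the simultaneous stabilization problem. (2) If there is a real rational Carathéodory function $F$ with $F(z_i)=M_i^{1/2}$ for all $i$, then there is one that also satisfies $\det D_c(\infty)\ne0$, so that the simultaneous stabilization problem is solvable by the compensator $K$ it gives. (3) Conversely, let $K=D_c^{-1}N_c$ be a solution of the simultaneous stabilization problem, where $N_c,D_c\in\mathbb H^{m\times m}$ are left coprime and $\det D_c\not\equiv0$. Then $\Delta_i=N_cN_i+D_cD_i$ ($i=0,1$) are unimodular. If $\Delta_0(s_i)^{-1}\Delta_1(s_i)=M_i$ for all $i$ and $\Delta_0^{-1}\Delta_1=F_1^2$ for a real rational Carathéodory function $F$, then $F(z_i)=M_i^{1/2}$ for all $i$ and $K=(m_{12}+F_1^2m_{22})^{-1}(m_{11}+F_1^2m_{21})$. -/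

import Mathlib

open scoped ComplexOrder

noncomputable section

namespace SimStab

/-- `f` is proper: it has no pole at infinity. -/
def IsProper (f : RatFunc ℝ) : Prop :=
  f.num.natDegree ≤ f.denom.natDegree

/-- The ring `ℍ`: proper real rational functions all of whose poles lie in the open left
half-plane. -/
def InH (f : RatFunc ℝ) : Prop :=
  IsProper f ∧ ∀ s : ℂ, 0 ≤ s.re → Polynomial.aeval s f.denom ≠ 0

/-- The set `𝕁` of multiplicative units of `ℍ`. -/
def InJ (f : RatFunc ℝ) : Prop :=
  InH f ∧ ∃ g : RatFunc ℝ, InH g ∧ f * g = 1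

/-- The value of a real rational function at a finite complex point (which is not a pole). -/
def evalAt (s : ℂ) (f : RatFunc ℝ) : ℂ :=
  RatFunc.eval (algebraMap ℝ ℂ) s f

/-- The value of a proper real rational function at infinity. -/
def evalInfty (f : RatFunc ℝ) : ℝ :=
  f.num.coeff f.denom.natDegree / f.denom.leadingCoeff

/-- The real rational function `s ↦ f ((1 - s) / (1 + s))`. -/
def mobius (f : RatFunc ℝ) : RatFunc ℝ :=
  RatFunc.eval RatFunc.C ((1 - RatFunc.X) / (1 + RatFunc.X)) f

/-- All entries of the matrix lie in `ℍ`. -/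
def MatInH {p q : Type} (A : Matrix p q (RatFunc ℝ)) : Prop :=
  ∀ i j, InH (A i j)

/-- All entries of the matrix are proper. -/
def MatProper {p q : Type} (A : Matrix p q (RatFunc ℝ)) : Prop :=
  ∀ i j, IsProper (A i j)

/-- A square matrix over `ℍ` whose determinant is a unit of `ℍ`. -/
def IsUnimodular {m : ℕ} (A : Matrix (Fin m) (Fin m) (RatFunc ℝ)) : Prop :=
  MatInH A ∧ InJ A.det

/-- `N` and `D` are left coprime over `ℍ` (Bezout identity). -/
def LeftCoprime {m : ℕ} (N D : Matrix (Fin m) (Fin m) (RatFunc ℝ)) : Prop :=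
  ∃ X Y : Matrix (Fin m) (Fin m) (RatFunc ℝ), MatInH X ∧ MatInH Y ∧ N * X + D * Y = 1

/-- `K` stabilizes `P`: the negative feedback loop is well defined and all its closed-loop transfer
matrices are proper with poles in the open left half-plane only. Here
`(1 + P * K)⁻¹ * P = P * (1 + K * P)⁻¹`. -/
def Stabilizes {m : ℕ} (K P : Matrix (Fin m) (Fin m) (RatFunc ℝ)) : Prop :=
  (1 + P * K).det ≠ 0 ∧
  MatInH (1 + P * K)⁻¹ ∧ MatInH ((1 + P * K)⁻¹ * P) ∧
  MatInH (K * (1 + P * K)⁻¹) ∧ MatInH (1 + K * P)⁻¹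

/-- The segment `A_lam = lam A₁ + (1 - lam) A₀`. -/
def segm {m : ℕ} (A₀ A₁ : Matrix (Fin m) (Fin m) (RatFunc ℝ)) (lam : ℝ) :
    Matrix (Fin m) (Fin m) (RatFunc ℝ) :=
  RatFunc.C lam • A₁ + RatFunc.C (1 - lam) • A₀

/-- The plant `P_lam = N_lam D_lam⁻¹`. -/
def plant {m : ℕ} (N₀ N₁ D₀ D₁ : Matrix (Fin m) (Fin m) (RatFunc ℝ)) (lam : ℝ) :
    Matrix (Fin m) (Fin m) (RatFunc ℝ) :=
  segm N₀ N₁ lam * (segm D₀ D₁ lam)⁻¹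

/-- `K` solves the simultaneous stabilization problem: it is a proper compensator and it stabilizes
all the plants `P_lam`, `lam ∈ [0,1]`. -/
def SolvesSimStab {m : ℕ} (N₀ N₁ D₀ D₁ K : Matrix (Fin m) (Fin m) (RatFunc ℝ)) : Prop :=
  MatProper K ∧ ∀ lam : ℝ, 0 ≤ lam → lam ≤ 1 → Stabilizes K (plant N₀ N₁ D₀ D₁ lam)

/-- The block matrix `M = [N₀ N₁; D₀ D₁]`. -/
def bigM {m : ℕ} (N₀ N₁ D₀ D₁ : Matrix (Fin m) (Fin m) (RatFunc ℝ)) :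
    Matrix (Fin m ⊕ Fin m) (Fin m ⊕ Fin m) (RatFunc ℝ) :=
  Matrix.fromBlocks N₀ N₁ D₀ D₁

/-- `Adj M / det M`, with blocks `m₁₁, m₁₂, m₂₁, m₂₂`. -/
def adjOverDet {m : ℕ} (M : Matrix (Fin m ⊕ Fin m) (Fin m ⊕ Fin m) (RatFunc ℝ)) :
    Matrix (Fin m ⊕ Fin m) (Fin m ⊕ Fin m) (RatFunc ℝ) :=
  (M.det)⁻¹ • M.adjugate

/-- `F` is a real rational (strict) Carathéodory function: it has no pole in the closed unit disc and
its Hermitian part is positive definite there. -/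
def IsCaratheodory {m : ℕ} (F : Matrix (Fin m) (Fin m) (RatFunc ℝ)) : Prop :=
  (∀ i j, ∀ z : ℂ, ‖z‖ ≤ 1 → Polynomial.aeval z (F i j).denom ≠ 0) ∧
  ∀ z : ℂ, ‖z‖ ≤ 1 → (F.map (evalAt z) + (F.map (evalAt z)).conjTranspose).PosDef

/-- `F₁(s) = F((1 - s) / (1 + s))`. -/
def pullback {m : ℕ} (F : Matrix (Fin m) (Fin m) (RatFunc ℝ)) :
    Matrix (Fin m) (Fin m) (RatFunc ℝ) :=
  F.map mobius

/-- `N_c = m₁₁ + F₁² m₂₁`. -/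
def compNum {m : ℕ} (N₀ N₁ D₀ D₁ F : Matrix (Fin m) (Fin m) (RatFunc ℝ)) :
    Matrix (Fin m) (Fin m) (RatFunc ℝ) :=
  (adjOverDet (bigM N₀ N₁ D₀ D₁)).toBlocks₁₁ +
    pullback F ^ 2 * (adjOverDet (bigM N₀ N₁ D₀ D₁)).toBlocks₂₁

/-- `D_c = m₁₂ + F₁² m₂₂`. -/
def compDen {m : ℕ} (N₀ N₁ D₀ D₁ F : Matrix (Fin m) (Fin m) (RatFunc ℝ)) :
    Matrix (Fin m) (Fin m) (RatFunc ℝ) :=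
  (adjOverDet (bigM N₀ N₁ D₀ D₁)).toBlocks₁₂ +
    pullback F ^ 2 * (adjOverDet (bigM N₀ N₁ D₀ D₁)).toBlocks₂₂

/-- The compensator `K = D_c⁻¹ N_c = (m₁₂ + F₁² m₂₂)⁻¹ (m₁₁ + F₁² m₂₁)`. -/
def compensator {m : ℕ} (N₀ N₁ D₀ D₁ F : Matrix (Fin m) (Fin m) (RatFunc ℝ)) :
    Matrix (Fin m) (Fin m) (RatFunc ℝ) :=
  (compDen N₀ N₁ D₀ D₁ F)⁻¹ * compNum N₀ N₁ D₀ D₁ F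

/-- `F` solves the interpolation problem `F(z_i) = S_i`, `z_i = (1 - s_i) / (1 + s_i)`, in the class
of real rational Carathéodory functions. -/
def SolvesInterp {m t : ℕ} (s : Fin t → ℂ) (S : Fin t → Matrix (Fin m) (Fin m) ℂ)
    (F : Matrix (Fin m) (Fin m) (RatFunc ℝ)) : Prop :=
  IsCaratheodory F ∧ ∀ i, F.map (evalAt ((1 - s i) / (1 + s i))) = S i

end SimStab

end

open SimStab

/-! Everything is read off from the row identity `[N_c D_c] M = [Δ₀ Δ₁]`. As `M` is invertible,
prescribing `Δ₀ = I`, `Δ₁ = Φ` forces `[N_c D_c] = [I Φ] M⁻¹`, and then `N_c N_λ + D_c D_λ = λΦ +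
(1-λ)I` by linearity. Stabilization along the segment thus reduces to unimodularity of this pencil.
For `Φ = F₁²` it factors as `(√λ F₁ + i√(1-λ))(√λ F₁ - i√(1-λ))`. The imaginary shifts do not change
the Hermitian part, so for `λ > 0` both factors are invertible at every point of the closed right
half-plane and at infinity (`det_segment_sq_ne_zero`). The only possible unstable poles of `[I Φ]
Adj(M)/det M` are the simple zeros `s_i`, and the conditions `F(z_i)² = M_i` cancel them
(`matInH_of_interp`).

For properness, `F` is perturbed by a multiple of a real polynomial vanishing at all `z_i` but not
at `-1`, the image of infinity. Compactness keeps the Hermitian part positive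
(`IsCaratheodory.eventually_add_smul`). At infinity `m₁₂` and `m₂₂` have trivial common kernel, so
`m₁₂ + B² m₂₂` is invertible for some real `B`, hence for all but finitely many values on the line
through `F(-1)` and `B` (`exists_interpolant_compDen_proper`).

For the converse, put `U = N_c N + D_c D`. Left coprimeness turns stability of the loop into `N U⁻¹,
D U⁻¹ ∈ ℍ`, so a null vector of `U(p)` is annihilated by `N(p)` and `D(p)`
(`isUnimodular_of_stabilizes`). Such a vector vanishes because `[I M_i]` kills `ker M(s_i)`, which
follows by differentiating `Adj(M) M = det M · I` at a simple zero
(`dotProduct_eq_zero_of_simple_zero`). Uniqueness of the square root with positive Hermitian part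
then gives `F(z_i) = M_i^{1/2}`. -/

namespace SimStab

open Polynomial Matrix Filter Topology

/-! ### Evaluation of real rational functions at points of the closed right half-plane -/

theorem evalAt_eq_div (w : ℂ) (f : RatFunc ℝ) :
    evalAt w f = aeval w f.num / aeval w f.denom := rfl

/-- The local ring of real rational functions without a pole at `w`. -/
def regularAt (w : ℂ) : Subring (RatFunc ℝ) where
  carrier := {f | aeval w f.denom ≠ 0}
  one_mem' := by simp
  zero_mem' := by simp
  mul_mem' {f g} hf hg h := by
    have := zero_dvd_iff.1 (h ▸ map_dvd (aeval w) (RatFunc.denom_mul_dvd f g))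
    rw [map_mul] at this
    exact (mul_ne_zero hf hg) this
  add_mem' {f g} hf hg h := by
    have := zero_dvd_iff.1 (h ▸ map_dvd (aeval w) (RatFunc.denom_add_dvd f g))
    rw [map_mul] at this
    exact (mul_ne_zero hf hg) this
  neg_mem' {f} hf h := by
    have hd : (-f).denom ∣ f.denom := by
      rw [RatFunc.denom_dvd f.denom_ne_zero]
      exact ⟨-f.num, by rw [map_neg, neg_div, RatFunc.num_div_denom]⟩
    exact hf (zero_dvd_iff.1 (h ▸ map_dvd (aeval w) hd))

theorem mem_regularAt {w : ℂ} {f : RatFunc ℝ} : f ∈ regularAt w ↔ aeval w f.denom ≠ 0 := Iff.rfl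

theorem evalAt_add {w : ℂ} {f g : RatFunc ℝ} (hf : f ∈ regularAt w) (hg : g ∈ regularAt w) :
    evalAt w (f + g) = evalAt w f + evalAt w g := RatFunc.eval_add _ _ hf hg

theorem evalAt_mul {w : ℂ} {f g : RatFunc ℝ} (hf : f ∈ regularAt w) (hg : g ∈ regularAt w) :
    evalAt w (f * g) = evalAt w f * evalAt w g := RatFunc.eval_mul _ _ hf hg

theorem div_mem_regularAt {w : ℂ} (p : ℝ[X]) {q : ℝ[X]} (hq : aeval w q ≠ 0) :
    (algebraMap ℝ[X] (RatFunc ℝ) p / algebraMap ℝ[X] (RatFunc ℝ) q) ∈ regularAt w := by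
  intro h
  exact hq (zero_dvd_iff.1 (h ▸ map_dvd (aeval w) (RatFunc.denom_div_dvd p q)))

theorem algebraMap_mem_regularAt (w : ℂ) (p : ℝ[X]) :
    algebraMap ℝ[X] (RatFunc ℝ) p ∈ regularAt w := by
  simp [mem_regularAt]

@[simp] theorem evalAt_algebraMap (w : ℂ) (p : ℝ[X]) :
    evalAt w (algebraMap ℝ[X] (RatFunc ℝ) p) = aeval w p := by
  simp [evalAt_eq_div]

@[simp] theorem evalAt_C (w : ℂ) (c : ℝ) : evalAt w (RatFunc.C c) = c := by
  simp [evalAt]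

theorem C_mem_regularAt (w : ℂ) (c : ℝ) : RatFunc.C c ∈ regularAt w := by
  rw [← RatFunc.algebraMap_C]; exact algebraMap_mem_regularAt _ _

/-- A rational function times the inverse of another one with a simple zero at `w` is regular
at `w` if the former vanishes there. -/
theorem mul_inv_mem_regularAt {w : ℂ} {f d : RatFunc ℝ}
    (hd : d ∈ regularAt w) (hf0 : evalAt w f = 0) (hf : f ∈ regularAt w)
    (hsimple : (d.num.map (algebraMap ℝ ℂ)).rootMultiplicity w = 1) :
    f * d⁻¹ ∈ regularAt w := by
  intro h
  have hd0 : d ≠ 0 := by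
    rintro rfl
    simp at hsimple
  have hinj : Function.Injective (algebraMap ℝ ℂ) := (algebraMap ℝ ℂ).injective
  rcases eq_or_ne f 0 with rfl | hfne
  · simp at h
  set g := f * d⁻¹ with hg
  have hg0 : g ≠ 0 := mul_ne_zero hfne (inv_ne_zero hd0)
  -- Cross-multiplied form of `g = f / d`. Comparing multiplicities of `w` on both sides, a pole of
  -- `g` would give at least two on the right and exactly one on the left.
  have key : g.num * (f.denom * d.num) = f.num * d.denom * g.denom := by
    rw [RatFunc.num_mul_eq_mul_denom_iff
      (mul_ne_zero f.denom_ne_zero (RatFunc.num_ne_zero hd0)), map_mul, map_mul,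
      ← div_mul_div_comm, RatFunc.num_div_denom, hg]
    conv_lhs => rw [← RatFunc.num_div_denom d]
    rw [inv_div]
  have hgn : aeval w g.num ≠ 0 := by
    intro h'
    obtain ⟨a, b, hab⟩ := RatFunc.isCoprime_num_denom g
    have := congrArg (aeval w) hab
    simp [h, h'] at this
  have key' := congrArg (fun p : ℝ[X] => (p.map (algebraMap ℝ ℂ)).rootMultiplicity w) key
  simp only [Polynomial.map_mul] at key'
  have hmap : ∀ p : ℝ[X], p ≠ 0 → p.map (algebraMap ℝ ℂ) ≠ 0 := fun p hp =>
    (Polynomial.map_ne_zero_iff hinj).2 hp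
  have h1 := hmap _ (RatFunc.num_ne_zero hg0)
  have h2 := hmap _ g.denom_ne_zero
  have h3 := hmap _ (RatFunc.num_ne_zero hfne)
  have h4 := hmap _ f.denom_ne_zero
  have h5 := hmap _ (RatFunc.num_ne_zero hd0)
  have h6 := hmap _ d.denom_ne_zero
  rw [rootMultiplicity_mul (by positivity), rootMultiplicity_mul (by positivity),
    rootMultiplicity_mul (by positivity), rootMultiplicity_mul (by positivity)] at key'
  have hzero : ∀ p : ℝ[X], aeval w p ≠ 0 → (p.map (algebraMap ℝ ℂ)).rootMultiplicity w = 0 := by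
    intro p hp
    apply rootMultiplicity_eq_zero
    rwa [IsRoot.def, eval_map_algebraMap]
  have hpos : ∀ p : ℝ[X], p.map (algebraMap ℝ ℂ) ≠ 0 → aeval w p = 0 →
      0 < (p.map (algebraMap ℝ ℂ)).rootMultiplicity w := by
    intro p hp0 hp
    rw [rootMultiplicity_pos hp0, IsRoot.def, eval_map_algebraMap, hp]
  have hfn : aeval w f.num = 0 := by
    rw [evalAt_eq_div, div_eq_zero_iff] at hf0
    exact hf0.resolve_right hf
  have e1 := hzero _ hgn
  have e2 := hzero _ hf
  have e3 := hzero _ hd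
  have e4 := hpos _ h2 h
  have e5 := hpos _ h3 hfn
  omega

/-! ### The value at infinity -/

/-- Properness and the value at infinity may be computed from any fraction, not only the reduced
one. Sums and products arrive unreduced. -/
theorem isProper_div {p q : ℝ[X]} (hq : q ≠ 0) (h : p.natDegree ≤ q.natDegree) :
    IsProper (algebraMap ℝ[X] (RatFunc ℝ) p / algebraMap ℝ[X] (RatFunc ℝ) q) ∧
    evalInfty (algebraMap ℝ[X] (RatFunc ℝ) p / algebraMap ℝ[X] (RatFunc ℝ) q) =
      p.coeff q.natDegree / q.leadingCoeff := by
  set f := algebraMap ℝ[X] (RatFunc ℝ) p / algebraMap ℝ[X] (RatFunc ℝ) q with hf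
  have key : f.num * q = p * f.denom := (RatFunc.num_mul_eq_mul_denom_iff hq).2 hf
  have hprop : f.num.natDegree ≤ f.denom.natDegree := by
    rcases eq_or_ne f.num 0 with h0 | h0
    · simp [h0]
    have hp : p ≠ 0 := by
      rintro rfl
      simp [hq, h0] at key
    have := congrArg natDegree key
    rw [natDegree_mul h0 hq, natDegree_mul hp f.denom_ne_zero] at this
    omega
  refine ⟨hprop, ?_⟩
  have hc := congrArg (fun r : ℝ[X] => r.coeff (f.denom.natDegree + q.natDegree)) key
  rw [coeff_mul_add_eq_of_natDegree_le hprop le_rfl, add_comm,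
    coeff_mul_add_eq_of_natDegree_le h le_rfl] at hc
  rw [evalInfty, div_eq_div_iff (leadingCoeff_ne_zero.2 f.denom_ne_zero)
    (leadingCoeff_ne_zero.2 hq)]
  exact hc

theorem isProper_mul_and {f g : RatFunc ℝ} (hf : IsProper f) (hg : IsProper g) :
    IsProper (f * g) ∧ evalInfty (f * g) = evalInfty f * evalInfty g := by
  have hne := mul_ne_zero f.denom_ne_zero g.denom_ne_zero
  have h : f * g = algebraMap ℝ[X] (RatFunc ℝ) (f.num * g.num) /
      algebraMap ℝ[X] (RatFunc ℝ) (f.denom * g.denom) := by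
    rw [map_mul, map_mul, ← div_mul_div_comm, RatFunc.num_div_denom, RatFunc.num_div_denom]
  have hd : (f.denom * g.denom).natDegree = f.denom.natDegree + g.denom.natDegree :=
    natDegree_mul f.denom_ne_zero g.denom_ne_zero
  obtain ⟨h1, h2⟩ := isProper_div (p := f.num * g.num) hne
    (natDegree_mul_le.trans (hd ▸ add_le_add hf hg))
  rw [← h] at h1 h2
  refine ⟨h1, h2.trans ?_⟩
  rw [hd, coeff_mul_add_eq_of_natDegree_le hf hg, leadingCoeff_mul, evalInfty, evalInfty, div_mul_div_comm]

theorem isProper_add_and {f g : RatFunc ℝ} (hf : IsProper f) (hg : IsProper g) :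
    IsProper (f + g) ∧ evalInfty (f + g) = evalInfty f + evalInfty g := by
  have hne := mul_ne_zero f.denom_ne_zero g.denom_ne_zero
  have h : f + g = algebraMap ℝ[X] (RatFunc ℝ) (f.num * g.denom + f.denom * g.num) /
      algebraMap ℝ[X] (RatFunc ℝ) (f.denom * g.denom) := by
    rw [map_mul, map_add, map_mul, map_mul, ← div_add_div _ _
      (RatFunc.algebraMap_ne_zero f.denom_ne_zero) (RatFunc.algebraMap_ne_zero g.denom_ne_zero),
      RatFunc.num_div_denom, RatFunc.num_div_denom]
  have hd : (f.denom * g.denom).natDegree = f.denom.natDegree + g.denom.natDegree :=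
    natDegree_mul f.denom_ne_zero g.denom_ne_zero
  obtain ⟨h1, h2⟩ := isProper_div (p := f.num * g.denom + f.denom * g.num) hne (by
    refine (natDegree_add_le _ _).trans (max_le ?_ ?_)
    · exact natDegree_mul_le.trans (hd ▸ add_le_add hf le_rfl)
    · exact natDegree_mul_le.trans (hd ▸ add_le_add le_rfl hg))
  rw [← h] at h1 h2
  refine ⟨h1, h2.trans ?_⟩
  rw [hd, coeff_add, coeff_mul_add_eq_of_natDegree_le hf le_rfl, coeff_mul_add_eq_of_natDegree_le le_rfl hg,
    leadingCoeff_mul, evalInfty, evalInfty,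
    div_add_div _ _ (leadingCoeff_ne_zero.2 f.denom_ne_zero)
      (leadingCoeff_ne_zero.2 g.denom_ne_zero)]
  rfl

theorem isProper_C (c : ℝ) : IsProper (RatFunc.C c) := by simp [IsProper]

@[simp] theorem evalInfty_C (c : ℝ) : evalInfty (RatFunc.C c) = c := by simp [evalInfty]

@[simp] theorem evalInfty_zero : evalInfty 0 = 0 := by simp [evalInfty]

@[simp] theorem evalInfty_one : evalInfty 1 = 1 := by simp [evalInfty]

/-- The ring of proper real rational functions. -/
def properRing : Subring (RatFunc ℝ) where
  carrier := {f | IsProper f}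
  one_mem' := by simp [IsProper]
  zero_mem' := by simp [IsProper]
  mul_mem' hf hg := (isProper_mul_and hf hg).1
  add_mem' hf hg := (isProper_add_and hf hg).1
  neg_mem' {f} hf := by
    have := (isProper_mul_and (isProper_C (-1)) hf).1
    rwa [map_neg, map_one, neg_one_mul] at this

/-- A nonzero numerator coefficient in the degree of the denominator bounds the denominator degree
by the numerator degree. -/
theorem isProper_inv {f : RatFunc ℝ} (h0 : evalInfty f ≠ 0) :
    IsProper f⁻¹ := by
  have hc : f.num.coeff f.denom.natDegree ≠ 0 := by
    intro h
    simp [evalInfty, h] at h0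
  have hle := le_natDegree_of_ne_zero hc
  have hn : f.num ≠ 0 := by
    intro h
    simp [h] at hc
  have : f⁻¹ = algebraMap ℝ[X] (RatFunc ℝ) f.denom / algebraMap ℝ[X] (RatFunc ℝ) f.num := by
    conv_lhs => rw [← RatFunc.num_div_denom f]
    rw [inv_div]
  rw [this]
  exact (isProper_div hn hle).1

/-! ### Points of the closed right half-plane, including infinity -/

/-- Evaluation at a point of the Riemann sphere, where `none` stands for infinity. -/
noncomputable def evPt : Option ℂ → RatFunc ℝ → ℂ
  | none, f => (evalInfty f : ℂ)
  | some w, f => evalAt w f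

/-- The closed right half-plane together with the point at infinity. -/
def InRHP (p : Option ℂ) : Prop := ∀ w, p = some w → 0 ≤ w.re

theorem inRHP_none : InRHP none := fun _ h => by simp at h

theorem inRHP_some {w : ℂ} (hw : 0 ≤ w.re) : InRHP (some w) := fun _ h =>
  (Option.some.inj h) ▸ hw

/-- The ring `ℍ`. -/
def ringH : Subring (RatFunc ℝ) where
  carrier := {f | InH f}
  one_mem' := ⟨properRing.one_mem, fun s _ => (regularAt s).one_mem⟩
  zero_mem' := ⟨properRing.zero_mem, fun s _ => (regularAt s).zero_mem⟩
  mul_mem' hf hg := ⟨properRing.mul_mem hf.1 hg.1,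
    fun s hs => (regularAt s).mul_mem (hf.2 s hs) (hg.2 s hs)⟩
  add_mem' hf hg := ⟨properRing.add_mem hf.1 hg.1,
    fun s hs => (regularAt s).add_mem (hf.2 s hs) (hg.2 s hs)⟩
  neg_mem' hf := ⟨properRing.neg_mem hf.1, fun s hs => (regularAt s).neg_mem (hf.2 s hs)⟩

theorem C_mem_ringH (c : ℝ) : RatFunc.C c ∈ ringH :=
  ⟨isProper_C c, fun s _ => C_mem_regularAt s c⟩

@[simp] theorem evPt_C (p : Option ℂ) (c : ℝ) : evPt p (RatFunc.C c) = c := by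
  cases p <;> simp [evPt]

/-- `e` is a ring homomorphism on the subring `R`. -/
def IsEval {K L : Type*} [Field K] [Field L] (R : Subring K) (e : K → L) : Prop :=
  ∃ φ : R →+* L, ∀ x : R, φ x = e x

theorem isEval_regularAt (w : ℂ) : IsEval (regularAt w) (evalAt w) :=
  ⟨{ toFun := fun x => evalAt w x
     map_one' := by simp [evalAt]
     map_zero' := by simp [evalAt]
     map_mul' := fun x y => evalAt_mul x.2 y.2
     map_add' := fun x y => evalAt_add x.2 y.2 }, fun _ => rfl⟩

theorem isEval_properRing : IsEval properRing evalInfty :=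
  ⟨{ toFun := fun x => evalInfty x
     map_one' := by simp
     map_zero' := by simp
     map_mul' := fun x y => (isProper_mul_and x.2 y.2).2
     map_add' := fun x y => (isProper_add_and x.2 y.2).2 }, fun _ => rfl⟩

theorem IsEval.mono {K L : Type*} [Field K] [Field L] {R S : Subring K} {e : K → L}
    (h : IsEval R e) (hSR : S ≤ R) : IsEval S e := by
  obtain ⟨φ, hφ⟩ := h
  exact ⟨φ.comp (Subring.inclusion hSR), fun x => hφ _⟩

theorem ringH_le_properRing : ringH ≤ properRing := fun _ h => h.1

theorem ringH_le_regularAt {w : ℂ} (hw : 0 ≤ w.re) : ringH ≤ regularAt w := fun _ h => h.2 w hw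

theorem isEval_ringH {p : Option ℂ} (hp : InRHP p) : IsEval ringH (evPt p) := by
  cases p with
  | none =>
    obtain ⟨φ, hφ⟩ := isEval_properRing.mono ringH_le_properRing
    exact ⟨Complex.ofRealHom.comp φ, fun x => by simp [hφ, evPt]⟩
  | some w => exact (isEval_regularAt w).mono (ringH_le_regularAt (hp w rfl))

section Scalar

variable {K L : Type*} [Field K] [Field L] {R : Subring K} {e : K → L}

theorem IsEval.map_add (h : IsEval R e) {x y : K} (hx : x ∈ R) (hy : y ∈ R) :
    e (x + y) = e x + e y := by
  obtain ⟨φ, hφ⟩ := h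
  simpa [hφ] using φ.map_add ⟨x, hx⟩ ⟨y, hy⟩

theorem IsEval.map_mul (h : IsEval R e) {x y : K} (hx : x ∈ R) (hy : y ∈ R) :
    e (x * y) = e x * e y := by
  obtain ⟨φ, hφ⟩ := h
  simpa [hφ] using φ.map_mul ⟨x, hx⟩ ⟨y, hy⟩

theorem IsEval.map_one (h : IsEval R e) : e 1 = 1 := by
  obtain ⟨φ, hφ⟩ := h
  simpa [hφ] using φ.map_one

theorem IsEval.map_zero (h : IsEval R e) : e 0 = 0 := by
  obtain ⟨φ, hφ⟩ := h
  simpa [hφ] using φ.map_zero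

end Scalar

/-- The denominator of `f⁻¹` divides the numerator of `f`, so poles of the inverse are zeros of `f`;
infinity is handled by degrees. -/
theorem inv_mem_ringH {f : RatFunc ℝ} (hf : f ∈ ringH) (h : ∀ p, InRHP p → evPt p f ≠ 0) :
    f⁻¹ ∈ ringH := by
  have hinf : evalInfty f ≠ 0 := by
    have := h none inRHP_none
    simpa [evPt] using this
  refine ⟨isProper_inv hinf, fun w hw h0 => ?_⟩
  have hw' : evalAt w f ≠ 0 := h (some w) (inRHP_some hw)
  have hf0 : f ≠ 0 := by
    rintro rfl
    simp at hinf
  have := zero_dvd_iff.1 (h0 ▸ map_dvd (aeval w) (RatFunc.denom_inv_dvd hf0))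
  simp [evalAt_eq_div, this] at hw'

theorem inJ_of_evPt_ne_zero {f : RatFunc ℝ} (hf : f ∈ ringH)
    (h : ∀ p, InRHP p → evPt p f ≠ 0) : InJ f := by
  refine ⟨hf, f⁻¹, inv_mem_ringH hf h, mul_inv_cancel₀ ?_⟩
  rintro rfl
  exact h none inRHP_none (isEval_ringH inRHP_none).map_zero

theorem InJ.evPt_ne_zero {f : RatFunc ℝ} (hf : InJ f) {p : Option ℂ} (hp : InRHP p) :
    evPt p f ≠ 0 := by
  obtain ⟨hf, g, hg, hfg⟩ := hf
  intro h0
  have := (isEval_ringH hp).map_mul hf hg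
  rw [hfg, h0, (isEval_ringH hp).map_one] at this
  simp at this

theorem InJ.inv_mem {f : RatFunc ℝ} (hf : InJ f) : f⁻¹ ∈ ringH :=
  inv_mem_ringH hf.1 fun _ hp => hf.evPt_ne_zero hp

/-! ### The Möbius substitution -/

/-- The image of a point of the closed right half-plane in the closed unit disc. -/
noncomputable def discPt : Option ℂ → ℂ
  | none => -1
  | some w => (1 - w) / (1 + w)

theorem one_add_ne_zero_of_re_nonneg {w : ℂ} (hw : 0 ≤ w.re) : 1 + w ≠ 0 := by
  intro h
  have := congrArg Complex.re h
  simp at this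
  linarith

theorem norm_discPt_le {p : Option ℂ} (hp : InRHP p) : ‖discPt p‖ ≤ 1 := by
  cases p with
  | none => simp [discPt]
  | some w =>
    have hw : 0 ≤ w.re := hp w rfl
    rw [discPt, norm_div, div_le_one (norm_pos_iff.2 (one_add_ne_zero_of_re_nonneg hw))]
    rw [← sq_le_sq₀ (norm_nonneg _) (norm_nonneg _), ← Complex.normSq_eq_norm_sq,
      ← Complex.normSq_eq_norm_sq, Complex.normSq_apply, Complex.normSq_apply]
    simp
    nlinarith

/-- The rational function `(1 - s) / (1 + s)`. -/
noncomputable def cayley : RatFunc ℝ := (1 - RatFunc.X) / (1 + RatFunc.X)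

theorem cayley_eq : cayley = algebraMap ℝ[X] (RatFunc ℝ) (1 - X) /
    algebraMap ℝ[X] (RatFunc ℝ) (X + C 1) := by
  simp [cayley, add_comm]

theorem cayley_mem : cayley ∈ ringH := by
  rw [cayley_eq]
  refine ⟨(isProper_div (X_add_C_ne_zero 1) ?_).1, fun w hw => div_mem_regularAt _ ?_⟩
  · rw [natDegree_X_add_C]
    compute_degree
  · simpa [add_comm] using one_add_ne_zero_of_re_nonneg hw

theorem evPt_cayley {p : Option ℂ} (hp : InRHP p) : evPt p cayley = discPt p := by
  cases p with
  | none =>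
    have h : (1 - X : ℝ[X]).natDegree ≤ (X + C (1 : ℝ)).natDegree := by
      rw [natDegree_X_add_C]
      compute_degree
    rw [evPt, cayley_eq, (isProper_div (X_add_C_ne_zero 1) h).2, natDegree_X_add_C,
      leadingCoeff_X_add_C]
    simp [discPt, coeff_one]
  | some w =>
    have hw : 0 ≤ w.re := hp w rfl
    have h1 := one_add_ne_zero_of_re_nonneg hw
    have hne : algebraMap ℝ[X] (RatFunc ℝ) (X + C 1) ≠ 0 :=
      RatFunc.algebraMap_ne_zero (X_add_C_ne_zero 1)
    -- Multiplying back by `1 + s` avoids computing the reduced numerator and denominator.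
    have h := evalAt_mul (cayley_mem.2 w hw) (algebraMap_mem_regularAt w (X + C 1))
    rw [cayley_eq, div_mul_cancel₀ _ hne, evalAt_algebraMap, evalAt_algebraMap, ← cayley_eq] at h
    simp only [evPt, discPt]
    rw [eq_div_iff h1, add_comm]
    simpa using h.symm

/-- The two claims are proved together because evaluation is additive and multiplicative only on
members of `ℍ`. -/
theorem eval₂_cayley (q : ℝ[X]) : q.eval₂ RatFunc.C cayley ∈ ringH ∧
    ∀ p, InRHP p → evPt p (q.eval₂ RatFunc.C cayley) = aeval (discPt p) q := by
  induction q using Polynomial.induction_on' with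
  | add a b ha hb =>
    rw [eval₂_add]
    refine ⟨ringH.add_mem ha.1 hb.1, fun p hp => ?_⟩
    rw [(isEval_ringH hp).map_add ha.1 hb.1, ha.2 p hp, hb.2 p hp, map_add]
  | monomial n c =>
    have hpow : ∀ k : ℕ, ∀ p, InRHP p → evPt p (cayley ^ k) = discPt p ^ k := by
      intro k p hp
      induction k with
      | zero => simp [(isEval_ringH hp).map_one]
      | succ k ih => rw [pow_succ, (isEval_ringH hp).map_mul (ringH.pow_mem cayley_mem k) cayley_mem,
          ih, evPt_cayley hp, pow_succ]
    rw [eval₂_monomial]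
    refine ⟨ringH.mul_mem (C_mem_ringH c) (ringH.pow_mem cayley_mem n), fun p hp => ?_⟩
    rw [(isEval_ringH hp).map_mul (C_mem_ringH c) (ringH.pow_mem cayley_mem n), hpow n p hp,
      aeval_monomial, evPt_C]
    rfl

/-- Real rational functions without poles in the closed unit disc. -/
def discRing : Subring (RatFunc ℝ) where
  carrier := {f | ∀ z : ℂ, ‖z‖ ≤ 1 → aeval z f.denom ≠ 0}
  one_mem' := fun z _ => (regularAt z).one_mem
  zero_mem' := fun z _ => (regularAt z).zero_mem
  mul_mem' hf hg := fun s hs => (regularAt s).mul_mem (hf s hs) (hg s hs)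
  add_mem' hf hg := fun s hs => (regularAt s).add_mem (hf s hs) (hg s hs)
  neg_mem' hf := fun s hs => (regularAt s).neg_mem (hf s hs)

theorem mobius_eq (f : RatFunc ℝ) :
    mobius f = f.num.eval₂ RatFunc.C cayley * (f.denom.eval₂ RatFunc.C cayley)⁻¹ := by
  rw [← div_eq_mul_inv]; rfl

theorem inJ_eval₂_cayley_denom {f : RatFunc ℝ} (hf : f ∈ discRing) :
    InJ (f.denom.eval₂ RatFunc.C cayley) := by
  refine inJ_of_evPt_ne_zero (eval₂_cayley _).1 fun p hp => ?_
  rw [(eval₂_cayley _).2 p hp]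
  exact hf _ (norm_discPt_le hp)

theorem mobius_mem {f : RatFunc ℝ} (hf : f ∈ discRing) : mobius f ∈ ringH := by
  rw [mobius_eq]
  exact ringH.mul_mem (eval₂_cayley _).1 (inJ_eval₂_cayley_denom hf).inv_mem

theorem evPt_mobius {f : RatFunc ℝ} (hf : f ∈ discRing) {p : Option ℂ} (hp : InRHP p) :
    evPt p (mobius f) = evalAt (discPt p) f := by
  have hJ := inJ_eval₂_cayley_denom hf
  have hne : f.denom.eval₂ RatFunc.C cayley ≠ 0 := by
    intro h
    have := hJ.evPt_ne_zero hp
    rw [h, (isEval_ringH hp).map_zero] at this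
    exact this rfl
  rw [evalAt_eq_div, eq_div_iff (hf _ (norm_discPt_le hp)), ← (eval₂_cayley _).2 p hp,
    ← (eval₂_cayley _).2 p hp, ← (isEval_ringH hp).map_mul (mobius_mem hf) (eval₂_cayley _).1,
    mobius_eq, inv_mul_cancel_right₀ hne]

/-! ### Matrices over a subring and evaluation -/

section MatrixEval

variable {K L : Type*} [Field K] [Field L] {R : Subring K} {e : K → L}
variable {n : Type*}

/-- All entries of the matrix lie in the subring `R`. -/
def MatIn (R : Subring K) {p q : Type*} (A : Matrix p q K) : Prop := ∀ i j, A i j ∈ R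

/-- Evaluation is a homomorphism on `R` only. Lifting to matrices over `R` lets products,
determinants and adjugates be transported along genuine ring homomorphisms. -/
theorem MatIn.exists_lift {p q : Type*} {A : Matrix p q K} (hA : MatIn R A) :
    ∃ A' : Matrix p q R, A'.map R.subtype = A :=
  ⟨Matrix.of fun i j => ⟨A i j, hA i j⟩, rfl⟩

theorem matIn_map {p q : Type*} (A' : Matrix p q R) : MatIn R (A'.map R.subtype) :=
  fun i j => (A' i j).2

theorem MatIn.mul [Fintype n] {A B : Matrix n n K} (hA : MatIn R A) (hB : MatIn R B) : MatIn R (A * B) :=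
  fun i j => by
    rw [Matrix.mul_apply]
    exact R.sum_mem fun k _ => R.mul_mem (hA i k) (hB k j)

theorem MatIn.add {A B : Matrix n n K} (hA : MatIn R A) (hB : MatIn R B) : MatIn R (A + B) :=
  fun i j => R.add_mem (hA i j) (hB i j)

theorem MatIn.sub {A B : Matrix n n K} (hA : MatIn R A) (hB : MatIn R B) : MatIn R (A - B) :=
  fun i j => R.sub_mem (hA i j) (hB i j)

theorem MatIn.smul {A : Matrix n n K} {c : K} (hc : c ∈ R) (hA : MatIn R A) : MatIn R (c • A) :=
  fun i j => R.mul_mem hc (hA i j)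

theorem MatIn.one [DecidableEq n] : MatIn R (1 : Matrix n n K) := fun i j => by
  rw [Matrix.one_apply]
  split_ifs
  exacts [R.one_mem, R.zero_mem]

theorem MatIn.adjugate [Fintype n] [DecidableEq n] {A : Matrix n n K} (hA : MatIn R A) : MatIn R A.adjugate := by
  obtain ⟨A', rfl⟩ := hA.exists_lift
  have := R.subtype.map_adjugate A'
  rw [RingHom.mapMatrix_apply, RingHom.mapMatrix_apply] at this
  rw [← this]
  exact matIn_map _

theorem MatIn.det [Fintype n] [DecidableEq n] {A : Matrix n n K} (hA : MatIn R A) : A.det ∈ R := by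
  obtain ⟨A', rfl⟩ := hA.exists_lift
  have := R.subtype.map_det A'
  rw [RingHom.mapMatrix_apply] at this
  rw [← this]
  exact Subtype.property _

theorem IsEval.map_matrix_mul [Fintype n] (h : IsEval R e) {A B : Matrix n n K} (hA : MatIn R A)
    (hB : MatIn R B) : (A * B).map e = A.map e * B.map e := by
  obtain ⟨φ, hφ⟩ := h
  obtain ⟨A', rfl⟩ := hA.exists_lift
  obtain ⟨B', rfl⟩ := hB.exists_lift
  have h1 : ∀ C : Matrix n n R, (C.map R.subtype).map e = C.map φ := fun C => by
    ext i j; simp [hφ]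
  rw [← Matrix.map_mul, h1, h1, h1, Matrix.map_mul]

theorem IsEval.map_matrix_add (h : IsEval R e) {A B : Matrix n n K} (hA : MatIn R A)
    (hB : MatIn R B) : (A + B).map e = A.map e + B.map e := by
  ext i j
  exact h.map_add (hA i j) (hB i j)

theorem IsEval.map_matrix_smul (h : IsEval R e) {A : Matrix n n K} {c : K} (hc : c ∈ R)
    (hA : MatIn R A) : (c • A).map e = e c • A.map e := by
  ext i j
  exact h.map_mul hc (hA i j)

theorem IsEval.map_matrix_one [DecidableEq n] (h : IsEval R e) : (1 : Matrix n n K).map e = 1 :=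
  Matrix.map_one _ h.map_zero h.map_one

theorem IsEval.map_matrix_adjugate [Fintype n] [DecidableEq n] (h : IsEval R e) {A : Matrix n n K} (hA : MatIn R A) :
    A.adjugate.map e = (A.map e).adjugate := by
  obtain ⟨φ, hφ⟩ := h
  obtain ⟨A', rfl⟩ := hA.exists_lift
  have h1 : ∀ C : Matrix n n R, (C.map R.subtype).map e = φ.mapMatrix C := fun C => by
    ext i j; simp [hφ]
  have h2 := R.subtype.map_adjugate A'
  rw [RingHom.mapMatrix_apply, RingHom.mapMatrix_apply] at h2
  rw [← h2, h1, h1, RingHom.map_adjugate]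

theorem IsEval.map_matrix_det [Fintype n] [DecidableEq n] (h : IsEval R e) {A : Matrix n n K} (hA : MatIn R A) :
    e A.det = (A.map e).det := by
  obtain ⟨φ, hφ⟩ := h
  obtain ⟨A', rfl⟩ := hA.exists_lift
  have h1 : ∀ C : Matrix n n R, (C.map R.subtype).map e = φ.mapMatrix C := fun C => by
    ext i j; simp [hφ]
  have h2 := R.subtype.map_det A'
  rw [RingHom.mapMatrix_apply] at h2
  rw [← h2, h1, ← RingHom.map_det, hφ]
  rfl

end MatrixEval

/-! ### Unimodular matrices and inverses of proper matrices -/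

theorem matInH_iff {p q : Type} {A : Matrix p q (RatFunc ℝ)} : MatInH A ↔ MatIn ringH A := Iff.rfl

theorem isUnimodular_of_det_ne_zero {m : ℕ} {A : Matrix (Fin m) (Fin m) (RatFunc ℝ)}
    (hA : MatInH A) (h : ∀ p, InRHP p → (A.map (evPt p)).det ≠ 0) : IsUnimodular A := by
  have hA' : MatIn ringH A := hA
  refine ⟨hA, inJ_of_evPt_ne_zero hA'.det fun p hp => ?_⟩
  rw [(isEval_ringH hp).map_matrix_det hA']
  exact h p hp

theorem IsUnimodular.det_ne_zero {m : ℕ} {A : Matrix (Fin m) (Fin m) (RatFunc ℝ)}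
    (hA : IsUnimodular A) : A.det ≠ 0 := by
  obtain ⟨_, _, g, _, hg⟩ := hA
  exact left_ne_zero_of_mul_eq_one hg

theorem IsUnimodular.matInH_inv {m : ℕ} {A : Matrix (Fin m) (Fin m) (RatFunc ℝ)}
    (hA : IsUnimodular A) : MatInH A⁻¹ := by
  have hA' : MatIn ringH A := hA.1
  rw [Matrix.inv_def, Ring.inverse_eq_inv']
  exact hA'.adjugate.smul hA.2.inv_mem

theorem matProper_inv {n : Type*} [Fintype n] [DecidableEq n] {A : Matrix n n (RatFunc ℝ)}
    (hA : MatIn properRing A) (h : (A.map evalInfty).det ≠ 0) : MatIn properRing A⁻¹ := by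
  rw [Matrix.inv_def, Ring.inverse_eq_inv']
  rw [← isEval_properRing.map_matrix_det hA] at h
  exact hA.adjugate.smul (isProper_inv h)

/-! ### Complex matrices with positive definite Hermitian part -/

section Complex

variable {n : Type*} [Fintype n]

theorem posDef_add_conjTranspose_iff {A : Matrix n n ℂ} :
    (A + Aᴴ).PosDef ↔ ∀ v : n → ℂ, v ≠ 0 → 0 < (star v ⬝ᵥ (A *ᵥ v)).re := by
  have key : ∀ v : n → ℂ, star v ⬝ᵥ ((A + Aᴴ) *ᵥ v) =
      ((2 * (star v ⬝ᵥ (A *ᵥ v)).re : ℝ) : ℂ) := by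
    intro v
    have h : star v ⬝ᵥ (Aᴴ *ᵥ v) = star (star v ⬝ᵥ (A *ᵥ v)) := by
      rw [star_dotProduct, star_mulVec, ← dotProduct_mulVec, conjTranspose_conjTranspose]
    rw [add_mulVec, dotProduct_add, h]
    exact Complex.add_conj _
  rw [Matrix.posDef_iff_dotProduct_mulVec]
  constructor
  · intro h v hv
    have := h.2 hv
    rw [key, Complex.zero_lt_real] at this
    linarith
  · intro h
    refine ⟨by rw [IsHermitian, conjTranspose_add, conjTranspose_conjTranspose, add_comm],
      fun v hv => ?_⟩
    rw [key, Complex.zero_lt_real]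
    linarith [h v hv]

theorem det_ne_zero_of_posDef_add_conjTranspose [DecidableEq n] {A : Matrix n n ℂ} (hA : (A + Aᴴ).PosDef) :
    A.det ≠ 0 := by
  intro h
  obtain ⟨v, hv, hAv⟩ := Matrix.exists_mulVec_eq_zero_iff.2 h
  have := posDef_add_conjTranspose_iff.1 hA v hv
  simp [hAv] at this

/-- Factor the pencil over `ℂ` as `(√λ A + i√(1-λ))(√λ A - i√(1-λ))`. Each factor has Hermitian part
`√λ (A + Aᴴ)`, and a null vector would make its quadratic form vanish. -/
theorem det_segment_sq_ne_zero [DecidableEq n] {A : Matrix n n ℂ} (hA : (A + Aᴴ).PosDef) {lam : ℝ}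
    (h0 : 0 ≤ lam) (h1 : lam ≤ 1) :
    ((lam : ℂ) • A ^ 2 + ((1 - lam : ℝ) : ℂ) • (1 : Matrix n n ℂ)).det ≠ 0 := by
  -- At `λ = 0` the factors lose their positive Hermitian part, but the pencil is the identity.
  rcases h0.eq_or_lt with rfl | hpos
  · simp
  have hsq : ((Real.sqrt lam : ℝ) : ℂ) ^ 2 = lam := by
    rw [← Complex.ofReal_pow, Real.sq_sqrt h0]
  have hsq' : ((Real.sqrt (1 - lam) : ℝ) : ℂ) ^ 2 = ((1 - lam : ℝ) : ℂ) := by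
    rw [← Complex.ofReal_pow, Real.sq_sqrt (by linarith)]
  have hfac : (lam : ℂ) • A ^ 2 + ((1 - lam : ℝ) : ℂ) • (1 : Matrix n n ℂ) =
      (((Real.sqrt lam : ℝ) : ℂ) • A + (Complex.I * (Real.sqrt (1 - lam) : ℝ)) • 1) *
      (((Real.sqrt lam : ℝ) : ℂ) • A + (-(Complex.I * (Real.sqrt (1 - lam) : ℝ))) • 1) := by
    have hI : Complex.I * ((Real.sqrt (1 - lam) : ℝ) : ℂ) *
        -(Complex.I * ((Real.sqrt (1 - lam) : ℝ) : ℂ)) = ((1 - lam : ℝ) : ℂ) := by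
      rw [← hsq', mul_neg, mul_mul_mul_comm, Complex.I_mul_I]
      ring
    simp only [add_mul, mul_add, smul_mul_smul_comm, mul_one, one_mul, ← sq A, hI]
    rw [← sq, hsq]
    module
  have hfactor : ∀ b : ℂ, b.re = 0 →
      (((Real.sqrt lam : ℝ) : ℂ) • A + b • (1 : Matrix n n ℂ)).det ≠ 0 := by
    intro b hb
    apply det_ne_zero_of_posDef_add_conjTranspose
    have : (((Real.sqrt lam : ℝ) : ℂ) • A + b • (1 : Matrix n n ℂ)) +
        (((Real.sqrt lam : ℝ) : ℂ) • A + b • (1 : Matrix n n ℂ))ᴴ =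
        ((Real.sqrt lam : ℝ) : ℂ) • (A + Aᴴ) := by
      have hb' : star b = -b := by
        apply Complex.ext <;> simp [hb]
      have hs' : star ((Real.sqrt lam : ℝ) : ℂ) = ((Real.sqrt lam : ℝ) : ℂ) := Complex.conj_ofReal _
      rw [conjTranspose_add, conjTranspose_smul, conjTranspose_smul, conjTranspose_one, hb', hs']
      module
    rw [this]
    apply hA.smul
    rw [Complex.zero_lt_real]
    exact Real.sqrt_pos.2 hpos
  rw [hfac, Matrix.det_mul]
  exact mul_ne_zero (hfactor _ (by simp)) (hfactor _ (by simp))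

/-- A square root with positive definite Hermitian part is unique. -/
theorem eq_of_sq_eq_sq_of_posDef [DecidableEq n] {A B : Matrix n n ℂ} (hA : (A + Aᴴ).PosDef)
    (hB : (B + Bᴴ).PosDef) (h : A ^ 2 = B ^ 2) : A = B := by
  set X := A - B with hX
  -- The difference of two square roots solves a homogeneous Sylvester equation. Its trace against
  -- `Xᴴ`, added to the adjoint version, is a sum of two nonnegative traces.
  have hsyl : A * X + X * B = 0 := by
    rw [hX, mul_sub, sub_mul, ← sq, ← sq, h]
    abel
  have hsyl' : Xᴴ * Aᴴ + Bᴴ * Xᴴ = 0 := by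
    simpa using congrArg conjTranspose hsyl
  have hA' := hA.posSemidef.conjTranspose_mul_mul_same X
  have hB' := hB.posSemidef.mul_mul_conjTranspose_same X
  have htr : (Xᴴ * (A + Aᴴ) * X).trace + (X * (B + Bᴴ) * Xᴴ).trace = 0 := by
    have e1 : (X * (B + Bᴴ) * Xᴴ).trace = (Xᴴ * (X * B) + (Bᴴ * Xᴴ) * X).trace := by
      rw [mul_add, add_mul, trace_add, trace_add, Matrix.trace_mul_comm, mul_assoc X,
        Matrix.trace_mul_comm X]
    rw [e1, ← trace_add]
    have : Xᴴ * (A + Aᴴ) * X + (Xᴴ * (X * B) + Bᴴ * Xᴴ * X) =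
        Xᴴ * (A * X + X * B) + (Xᴴ * Aᴴ + Bᴴ * Xᴴ) * X := by
      noncomm_ring
    rw [this, hsyl, hsyl']
    simp
  have hz := ((add_eq_zero_iff_of_nonneg hA'.trace_nonneg hB'.trace_nonneg).1 htr).1
  rw [hA'.trace_eq_zero_iff] at hz
  have hX0 : X = 0 := by
    apply Matrix.ext_of_mulVec_single
    intro i
    by_contra hne
    rw [zero_mulVec] at hne
    have hp := hA.dotProduct_mulVec_pos hne
    have : star (X *ᵥ Pi.single i 1) ⬝ᵥ ((A + Aᴴ) *ᵥ (X *ᵥ Pi.single i 1)) =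
        star (Pi.single i 1) ⬝ᵥ ((Xᴴ * (A + Aᴴ) * X) *ᵥ Pi.single i 1) := by
      rw [star_mulVec, ← dotProduct_mulVec, mulVec_mulVec, mulVec_mulVec, mul_assoc]
    rw [this, hz] at hp
    simp at hp
  exact sub_eq_zero.1 hX0

end Complex

/-! ### Simple zeros of a determinant -/

theorem eventually_mem_regularAt {w : ℂ} {f : RatFunc ℝ} (hf : f ∈ regularAt w) :
    ∀ᶠ z in 𝓝 w, f ∈ regularAt z :=
  (f.denom.continuous_aeval (A := ℂ)).continuousAt.eventually_ne hf

theorem differentiableAt_evalAt {w : ℂ} {f : RatFunc ℝ} (hf : f ∈ regularAt w) :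
    DifferentiableAt ℂ (fun z => evalAt z f) w :=
  (f.num.differentiable_aeval w).div (f.denom.differentiable_aeval w) hf

theorem hasDerivAt_evalAt_of_simple_zero {w : ℂ} {f : RatFunc ℝ} (hf : f ∈ regularAt w)
    (h : (f.num.map (algebraMap ℝ ℂ)).rootMultiplicity w = 1) :
    evalAt w f = 0 ∧ ∃ c : ℂ, c ≠ 0 ∧ HasDerivAt (fun z => evalAt z f) c w := by
  have hn : f.num.map (algebraMap ℝ ℂ) ≠ 0 := by
    intro h0
    simp [h0] at h
  have hroot : (f.num.map (algebraMap ℝ ℂ)).IsRoot w :=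
    (rootMultiplicity_pos hn).1 (by omega)
  have hder : ¬ (derivative (f.num.map (algebraMap ℝ ℂ))).IsRoot w := by
    intro h'
    have := (one_lt_rootMultiplicity_iff_isRoot hn).2 ⟨hroot, h'⟩
    omega
  rw [IsRoot.def, eval_map_algebraMap] at hroot
  rw [derivative_map, IsRoot.def, eval_map_algebraMap] at hder
  refine ⟨by rw [evalAt_eq_div, hroot, zero_div], _, ?_,
    (f.num.hasDerivAt_aeval w).div (f.denom.hasDerivAt_aeval w) hf⟩
  rw [hroot, zero_mul, sub_zero]
  exact div_ne_zero (mul_ne_zero hder hf) (pow_ne_zero _ hf)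

/-- At a simple zero `w` of `det B`, a row vector killing `adj B(w)` also kills `ker B(w)`. -/
theorem dotProduct_eq_zero_of_simple_zero {n : Type*} [Fintype n] [DecidableEq n]
    {B : Matrix n n (RatFunc ℝ)} {w : ℂ} (hB : MatIn (regularAt w) B)
    (hsimple : (B.det.num.map (algebraMap ℝ ℂ)).rootMultiplicity w = 1)
    {r u : n → ℂ} (hr : r ᵥ* (B.map (evalAt w)).adjugate = 0)
    (hu : (B.map (evalAt w)) *ᵥ u = 0) : r ⬝ᵥ u = 0 := by
  obtain ⟨-, c, hc, hder⟩ := hasDerivAt_evalAt_of_simple_zero hB.det hsimple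
  have hBev : ∀ᶠ z in 𝓝 w, MatIn (regularAt z) B :=
    eventually_all.2 fun i => eventually_all.2 fun j => eventually_mem_regularAt (hB i j)
  -- This is `adj(B) B = det B · 1` sandwiched between `r` and `u`. At `w` both factors on the right
  -- vanish, so the derivative of the right side is zero, while `det B` has nonzero derivative
  -- there.
  have hid : ∀ᶠ z in 𝓝 w, evalAt z B.det * (r ⬝ᵥ u) =
      ∑ j, (r ᵥ* B.adjugate.map (evalAt z)) j * ((B.map (evalAt z)) *ᵥ u) j := by
    filter_upwards [hBev] with z hz
    have h1 := (isEval_regularAt z).map_matrix_adjugate hz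
    have h2 := (isEval_regularAt z).map_matrix_det hz
    change _ = (r ᵥ* B.adjugate.map (evalAt z)) ⬝ᵥ ((B.map (evalAt z)) *ᵥ u)
    rw [h1, h2, dotProduct_mulVec, vecMul_vecMul, adjugate_mul, vecMul_smul, vecMul_one,
      smul_dotProduct, smul_eq_mul]
  have hd1 : ∀ j, DifferentiableAt ℂ (fun z => (r ᵥ* B.adjugate.map (evalAt z)) j) w := by
    intro j
    simp only [vecMul, dotProduct, map_apply]
    exact DifferentiableAt.fun_sum fun i _ =>
      (differentiableAt_evalAt (hB.adjugate i j)).const_mul _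
  have hd2 : ∀ j, DifferentiableAt ℂ (fun z => ((B.map (evalAt z)) *ᵥ u) j) w := by
    intro j
    simp only [mulVec, dotProduct, map_apply]
    exact DifferentiableAt.fun_sum fun i _ =>
      (differentiableAt_evalAt (hB j i)).mul_const _
  have hrhs : HasDerivAt (fun z => ∑ j, (r ᵥ* B.adjugate.map (evalAt z)) j *
      ((B.map (evalAt z)) *ᵥ u) j) 0 w := by
    have := HasDerivAt.fun_sum (u := Finset.univ) fun j _ =>
      (hd1 j).hasDerivAt.mul (hd2 j).hasDerivAt
    convert! this using 1
    symm
    apply Finset.sum_eq_zero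
    intro j _
    rw [(isEval_regularAt w).map_matrix_adjugate hB, hr, hu]
    simp
  have := (hder.mul_const (r ⬝ᵥ u)).unique (hrhs.congr_of_eventuallyEq hid)
  exact (mul_eq_zero.1 this).resolve_left hc

/-! ### Perturbation of Carathéodory functions -/

theorem continuousAt_evalAt {w : ℂ} {f : RatFunc ℝ} (hf : f ∈ regularAt w) :
    ContinuousAt (fun z => evalAt z f) w := (differentiableAt_evalAt hf).continuousAt

/-- The quadratic form is jointly continuous in `(ε, z, v)` and positive at `ε = 0` on the compact
product of the closed disc and the unit sphere. Homogeneity in `v` extends positivity to all nonzero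
vectors. -/
theorem IsCaratheodory.eventually_add_smul {m : ℕ} {F G : Matrix (Fin m) (Fin m) (RatFunc ℝ)}
    (hF : IsCaratheodory F) (hG : MatIn discRing G) :
    ∀ᶠ ε in 𝓝 (0 : ℝ), IsCaratheodory (F + RatFunc.C ε • G) := by
  have hF' : MatIn discRing F := hF.1
  have hC : ∀ c : ℝ, RatFunc.C c ∈ discRing := fun c z _ => C_mem_regularAt z c
  set q : ℝ → ℂ × (Fin m → ℂ) → ℂ := fun ε x =>
    ∑ i, star (x.2 i) * ∑ j, (evalAt x.1 (F i j) + ε * evalAt x.1 (G i j)) * x.2 j with hq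
  have hqeq : ∀ ε : ℝ, ∀ z : ℂ, ‖z‖ ≤ 1 → ∀ v : Fin m → ℂ,
      star v ⬝ᵥ (((F + RatFunc.C ε • G).map (evalAt z)) *ᵥ v) = q ε (z, v) := by
    intro ε z hz v
    have h1 : MatIn (regularAt z) F := fun i j => hF' i j z hz
    have h2 : MatIn (regularAt z) G := fun i j => hG i j z hz
    rw [(isEval_regularAt z).map_matrix_add h1 (h2.smul (C_mem_regularAt z ε)),
      (isEval_regularAt z).map_matrix_smul (C_mem_regularAt z ε) h2, evalAt_C]
    simp [hq, dotProduct, mulVec]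
  have hpos0 : ∀ z : ℂ, ‖z‖ ≤ 1 → ∀ v : Fin m → ℂ, v ≠ 0 → 0 < (q 0 (z, v)).re := by
    intro z hz v hv
    rw [← hqeq 0 z hz v, RingHom.map_zero, zero_smul, add_zero]
    exact posDef_add_conjTranspose_iff.1 (hF.2 z hz) v hv
  have hcont : ∀ z : ℂ, ‖z‖ ≤ 1 → ∀ v : Fin m → ℂ,
      ContinuousAt (fun y : ℝ × (ℂ × (Fin m → ℂ)) => (q y.1 y.2).re) (0, (z, v)) := by
    intro z hz v
    have hev : ∀ f ∈ discRing, ContinuousAt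
        (fun y : ℝ × (ℂ × (Fin m → ℂ)) => evalAt y.2.1 f) (0, (z, v)) := fun f hf =>
      ContinuousAt.comp (f := fun y : ℝ × (ℂ × (Fin m → ℂ)) => y.2.1) (g := fun z => evalAt z f)
        (x := (0, (z, v))) (continuousAt_evalAt (hf z hz)) (by fun_prop)
    refine Complex.continuous_re.continuousAt.comp ?_
    simp only [hq]
    refine tendsto_finsetSum _ fun i _ => ContinuousAt.mul (by fun_prop) ?_
    refine tendsto_finsetSum _ fun j _ => ContinuousAt.mul ?_ (by fun_prop)
    exact (hev _ (hF' i j)).add (ContinuousAt.mul (by fun_prop) (hev _ (hG i j)))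
  have hK : IsCompact (Metric.closedBall (0 : ℂ) 1 ×ˢ Metric.sphere (0 : Fin m → ℂ) 1) :=
    (isCompact_closedBall _ _).prod (isCompact_sphere _ _)
  have hev := hK.eventually_forall_of_forall_eventually (x₀ := (0 : ℝ))
    (P := fun ε x => 0 < (q ε x).re) (by
      rintro ⟨z, v⟩ ⟨hz, hv⟩
      have hz' : ‖z‖ ≤ 1 := by simpa using hz
      have hv' : v ≠ 0 := by
        rintro rfl
        simp at hv
      exact (hcont z hz' v).eventually (lt_mem_nhds (hpos0 z hz' v hv')))
  filter_upwards [hev] with ε hε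
  refine ⟨fun i j => discRing.add_mem (hF' i j) (discRing.mul_mem (hC ε) (hG i j)),
    fun z hz => posDef_add_conjTranspose_iff.2 fun v hv => ?_⟩
  rw [hqeq ε z hz]
  have hnorm : ‖v‖ ≠ 0 := norm_ne_zero_iff.2 hv
  have hmem := hε (z, ((‖v‖⁻¹ : ℝ) : ℂ) • v) ⟨by simpa using hz, by
    simp [norm_smul, hnorm]⟩
  have hscale : q ε (z, ((‖v‖⁻¹ : ℝ) : ℂ) • v) = ((‖v‖⁻¹ * ‖v‖⁻¹ : ℝ) : ℂ) * q ε (z, v) := by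
    rw [← hqeq ε z hz, ← hqeq ε z hz, mulVec_smul, star_smul, smul_dotProduct, dotProduct_smul,
      smul_eq_mul, smul_eq_mul, ← mul_assoc, Complex.ofReal_mul]
    congr 2
    exact Complex.conj_ofReal _
  rw [hscale, Complex.re_ofReal_mul] at hmem
  exact pos_of_mul_pos_right hmem (mul_self_nonneg _)

/-! ### Generic invertibility -/

/-- Squaring has derivative `x ↦ 2x` at `1`, an isomorphism, so the inverse function theorem makes
it locally onto. -/
theorem eventually_exists_sq_eq {A : Type*} [NormedRing A] [NormedAlgebra ℝ A] [CompleteSpace A] :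
    ∀ᶠ y in 𝓝 (1 : A), ∃ x : A, x ^ 2 = y := by
  have hd : HasStrictFDerivAt (fun x : A => x ^ 2)
      ((ContinuousLinearEquiv.smulLeft (Units.mk0 (2 : ℝ) two_ne_zero) : A ≃L[ℝ] A) :
        A →L[ℝ] A) 1 := by
    have h := (hasStrictFDerivAt_id (𝕜 := ℝ) (1 : A)).mul' (hasStrictFDerivAt_id (1 : A))
    convert! h using 1
    · ext x
      simp [sq]
    · ext x
      simp [Units.smul_def, two_smul]
  have := hd.map_nhds_eq_of_equiv
  rw [one_pow] at this
  rw [← this]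
  exact eventually_map.2 (Eventually.of_forall fun x => ⟨x, rfl⟩)

theorem eventually_exists_matrix_sq_eq {n : Type*} [Fintype n] [DecidableEq n] :
    ∀ᶠ y in 𝓝 (1 : Matrix n n ℝ), ∃ x : Matrix n n ℝ, x ^ 2 = y := by
  let _ : NormedRing (Matrix n n ℝ) := Matrix.linftyOpNormedRing
  let _ : NormedAlgebra ℝ (Matrix n n ℝ) := Matrix.linftyOpNormedAlgebra
  exact eventually_exists_sq_eq

/-- A square pencil of matrices that is invertible at one point is invertible near every point. -/
theorem eventually_det_eval_ne_zero {n : Type*} [Fintype n] [DecidableEq n]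
    (G : Matrix n n ℝ[X]) {x₀ : ℝ} (h : (G.map (eval x₀)).det ≠ 0) (x : ℝ) :
    ∀ᶠ y in 𝓝[≠] x, (G.map (eval y)).det ≠ 0 := by
  have hdet : ∀ y : ℝ, (G.map (eval y)).det = G.det.eval y := fun y => by
    have := (evalRingHom y).map_det G
    simpa using this.symm
  have hne : G.det ≠ 0 := by
    intro h0
    rw [hdet, h0, eval_zero] at h
    exact h rfl
  have hfin : {y : ℝ | G.det.eval y = 0}.Finite := by
    refine (G.det.roots.toFinset.finite_toSet).subset fun y hy => ?_
    simpa [hne] using hy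
  filter_upwards [nhdsNE_le_cofinite x hfin.compl_mem_cofinite] with y hy
  rw [hdet]
  exact hy

/-- If `P` and `Q` have trivial common kernel, then some `P + C Q` is invertible. -/
theorem exists_det_add_mul_ne_zero {n : Type*} [Fintype n] [DecidableEq n]
    {P Q X Y : Matrix n n ℝ} (h : X * P + Y * Q = 1) :
    ∃ C : Matrix n n ℝ, (P + C * Q).det ≠ 0 := by
  set p := Matrix.toLin' P with hp
  set q := Matrix.toLin' Q with hq
  have hker : ∀ v, p v = 0 → q v = 0 → v = 0 := by
    intro v h1 h2
    rw [hp, toLin'_apply] at h1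
    rw [hq, toLin'_apply] at h2
    have := congrArg (· *ᵥ v) h
    simpa [add_mulVec, ← mulVec_mulVec, h1, h2] using this.symm
  -- The kernel of `p` has the dimension of a complement `S` of its range, and `q` is injective on
  -- that kernel. So `c` can be chosen with values in `S` and carrying `q (ker p)` isomorphically
  -- onto `S`. Then `p v + c (q v) = 0` puts `p v` in `range p ∩ S = 0`.
  obtain ⟨S, hS⟩ := Submodule.exists_isCompl (LinearMap.range p)
  have hinj : LinearMap.ker (q.domRestrict (LinearMap.ker p)) = ⊥ := by
    rw [LinearMap.ker_eq_bot']
    rintro ⟨v, hv⟩ hqv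
    exact Subtype.ext (hker v hv hqv)
  obtain ⟨g, hg⟩ := LinearMap.exists_leftInverse_of_injective _ hinj
  have hdim : Module.finrank ℝ (LinearMap.ker p) = Module.finrank ℝ S := by
    have h1 := LinearMap.finrank_range_add_finrank_ker p
    have h2 := Submodule.finrank_add_eq_of_isCompl hS
    omega
  set φ := LinearEquiv.ofFinrankEq _ _ hdim with hφ
  set c : (n → ℝ) →ₗ[ℝ] (n → ℝ) := S.subtype ∘ₗ φ.toLinearMap ∘ₗ g with hc
  refine ⟨LinearMap.toMatrix' c, fun hdet => ?_⟩
  obtain ⟨v, hv, hPv⟩ := Matrix.exists_mulVec_eq_zero_iff.2 hdet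
  apply hv
  rw [add_mulVec, ← mulVec_mulVec, LinearMap.toMatrix'_mulVec, ← toLin'_apply,
    ← toLin'_apply Q] at hPv
  have hcS : c (q v) ∈ S := by simp [hc]
  have hpv : p v ∈ S := by
    rw [eq_neg_of_add_eq_zero_left hPv]
    exact S.neg_mem hcS
  have hp0 : p v = 0 := Submodule.disjoint_def.1 hS.disjoint _ (LinearMap.mem_range_self p v) hpv
  have hcq : c (q v) = 0 := by
    rw [← hPv]
    change c (q v) = p v + c (q v)
    rw [hp0, zero_add]
  have hgq : g (q v) = ⟨v, hp0⟩ := by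
    have := LinearMap.congr_fun hg ⟨v, hp0⟩
    simpa using this
  rw [hc, LinearMap.comp_apply, LinearMap.comp_apply, hgq] at hcq
  have h3 : φ ⟨v, hp0⟩ = 0 := Subtype.ext hcq
  exact congrArg Subtype.val (φ.map_eq_zero_iff.1 h3)

theorem map_eval_pencil {n : Type*} (A E : Matrix n n ℝ) (y : ℝ) :
    (A.map C + (X : ℝ[X]) • E.map C).map (eval y) = A + y • E := by
  ext i j
  simp [smul_eq_mul, mul_comm (E i j)]

theorem map_eval_mul {n : Type*} [Fintype n] (A B : Matrix n n ℝ[X]) (y : ℝ) :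
    (A * B).map (eval y) = A.map (eval y) * B.map (eval y) :=
  Matrix.map_mul (f := evalRingHom y)

theorem map_eval_add {n : Type*} (A B : Matrix n n ℝ[X]) (y : ℝ) :
    (A + B).map (eval y) = A.map (eval y) + B.map (eval y) :=
  Matrix.map_add (evalRingHom y) (map_add _) A B

theorem map_eval_map_C {n : Type*} (A : Matrix n n ℝ) (y : ℝ) : (A.map C).map (eval y) = A := by
  ext i j
  simp

/-- Join `1` to a good coefficient `C₀` by a line. The determinant is a nonzero polynomial along it,
so good points occur arbitrarily near `1`, where every real matrix is a square. -/
theorem exists_det_add_sq_mul_ne_zero {n : Type*} [Fintype n] [DecidableEq n]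
    {P Q U V : Matrix n n ℝ} (h : U * P + V * Q = 1) :
    ∃ B : Matrix n n ℝ, (P + B ^ 2 * Q).det ≠ 0 := by
  obtain ⟨C₀, hC₀⟩ := exists_det_add_mul_ne_zero h
  set G := P.map C + ((1 : Matrix n n ℝ).map C + (X : ℝ[X]) • (C₀ - 1).map C) * Q.map C with hG
  have heval : ∀ y : ℝ, G.map (eval y) = P + (1 + y • (C₀ - 1)) * Q := fun y => by
    rw [hG, map_eval_add, map_eval_mul, map_eval_pencil, map_eval_map_C, map_eval_map_C]
  have h1 := eventually_det_eval_ne_zero G (x₀ := 1) (by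
    rwa [heval, one_smul, add_sub_cancel]) 0
  have hcont : Tendsto (fun y : ℝ => 1 + y • (C₀ - 1)) (𝓝[≠] 0) (𝓝 1) := by
    have : Continuous fun y : ℝ => 1 + y • (C₀ - 1) := by fun_prop
    simpa using (this.tendsto 0).mono_left nhdsWithin_le_nhds
  obtain ⟨y, hy, B, hB⟩ := (h1.and (hcont.eventually eventually_exists_matrix_sq_eq)).exists
  exact ⟨B, by rwa [hB, ← heval]⟩

/-- Invertibility of `P + B² Q` for one `B` gives it near every `A`, in the direction of `B`. -/
theorem eventually_det_add_sq_mul_ne_zero {n : Type*} [Fintype n] [DecidableEq n]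
    {P Q B : Matrix n n ℝ} (h : (P + B ^ 2 * Q).det ≠ 0) (A : Matrix n n ℝ) :
    ∀ᶠ ε in 𝓝[≠] (0 : ℝ), (P + (A + ε • (B - A)) ^ 2 * Q).det ≠ 0 := by
  set T := A.map C + (X : ℝ[X]) • (B - A).map C with hT
  have heval : ∀ y : ℝ, (P.map C + T * T * Q.map C).map (eval y) =
      P + (A + y • (B - A)) ^ 2 * Q := fun y => by
    rw [map_eval_add, map_eval_mul, map_eval_mul, hT, map_eval_pencil, map_eval_map_C,
      map_eval_map_C, sq]
  have h1 := eventually_det_eval_ne_zero (P.map C + T * T * Q.map C) (x₀ := 1) (by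
    rwa [heval, one_smul, add_sub_cancel]) 0
  simpa only [heval] using h1

/-! ### The closed loop -/

section ClosedLoop

variable {m : ℕ} {N D Nc Dc : Matrix (Fin m) (Fin m) (RatFunc ℝ)}

theorem one_add_mul_eq (hDc : Dc.det ≠ 0) (hD : D.det ≠ 0) :
    Nc * N + Dc * D = Dc * (1 + Dc⁻¹ * Nc * (N * D⁻¹)) * D := by
  have h1 : Dc * Dc⁻¹ = 1 := Matrix.mul_nonsing_inv _ hDc.isUnit
  have h2 : D⁻¹ * D = 1 := Matrix.nonsing_inv_mul _ hD.isUnit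
  calc Nc * N + Dc * D = (Dc * Dc⁻¹) * Nc * N * (D⁻¹ * D) + Dc * D := by simp [h1, h2]
    _ = _ := by noncomm_ring

/-- The closed loop transfer matrices in terms of coprime factors. -/
theorem closedLoop_eq (hDc : Dc.det ≠ 0) (hD : D.det ≠ 0) (hU : (Nc * N + Dc * D).det ≠ 0) :
    (1 + N * D⁻¹ * (Dc⁻¹ * Nc)).det ≠ 0 ∧
    (1 + N * D⁻¹ * (Dc⁻¹ * Nc))⁻¹ = 1 - N * (Nc * N + Dc * D)⁻¹ * Nc ∧
    (1 + N * D⁻¹ * (Dc⁻¹ * Nc))⁻¹ * (N * D⁻¹) = N * (Nc * N + Dc * D)⁻¹ * Dc ∧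
    Dc⁻¹ * Nc * (1 + N * D⁻¹ * (Dc⁻¹ * Nc))⁻¹ = D * (Nc * N + Dc * D)⁻¹ * Nc ∧
    (1 + Dc⁻¹ * Nc * (N * D⁻¹))⁻¹ = D * (Nc * N + Dc * D)⁻¹ * Dc := by
  have h1 : Dc⁻¹ * Dc = 1 := Matrix.nonsing_inv_mul _ hDc.isUnit
  have h1' : Dc * Dc⁻¹ = 1 := Matrix.mul_nonsing_inv _ hDc.isUnit
  have h2 : D⁻¹ * D = 1 := Matrix.nonsing_inv_mul _ hD.isUnit
  have h3 : (Nc * N + Dc * D) * (Nc * N + Dc * D)⁻¹ = 1 := Matrix.mul_nonsing_inv _ hU.isUnit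
  set V := (Nc * N + Dc * D)⁻¹ with hV
  set K := Dc⁻¹ * Nc with hK
  set P := N * D⁻¹ with hP
  set W := D * V * Dc with hW
  have hPD : P * D = N := by rw [hP, mul_assoc, h2, mul_one]
  have hDK : Dc * K = Nc := by rw [hK, ← mul_assoc, h1', one_mul]
  -- All four formulas follow from this one inverse; `(1 + P K)⁻¹ = 1 - P (1 + K P)⁻¹ K` gives the
  -- other loop.
  have hright : (1 + K * P) * W = 1 := by
    calc (1 + K * P) * W = (D + K * (P * D)) * V * Dc := by rw [hW]; noncomm_ring
      _ = (Dc⁻¹ * Dc * D + Dc⁻¹ * Nc * N) * V * Dc := by rw [hPD, h1, one_mul, hK]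
      _ = Dc⁻¹ * ((Nc * N + Dc * D) * V) * Dc := by noncomm_ring
      _ = 1 := by rw [h3, mul_one, h1]
  have hleft : W * (1 + K * P) = 1 := mul_eq_one_comm.1 hright
  have hPW : P * W = N * V * Dc := by
    rw [hW, ← mul_assoc, ← mul_assoc, hPD]
  have hWK : W * K = D * V * Nc := by
    rw [hW, mul_assoc _ Dc K, hDK]
  have hPWK : P * W * K = N * V * Nc := by
    rw [hPW, mul_assoc _ Dc K, hDK]
  have hr2 : (1 + P * K) * (1 - P * W * K) = 1 := by
    calc (1 + P * K) * (1 - P * W * K) = 1 + P * K - P * ((1 + K * P) * W) * K := by noncomm_ring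
      _ = 1 := by rw [hright]; noncomm_ring
  have hinv : (1 + P * K)⁻¹ = 1 - P * W * K := Matrix.inv_eq_right_inv hr2
  refine ⟨(Matrix.isUnit_det_of_right_inverse hr2).ne_zero, hPWK ▸ hinv, ?_, ?_,
    Matrix.inv_eq_right_inv hright⟩
  · rw [hinv, ← hPW]
    calc (1 - P * W * K) * P = P * (W * (1 + K * P)) - P * W * K * P + (P - P * (W * (1 + K * P)))
          := by noncomm_ring
      _ = P * W := by rw [hleft]; nth_rw 1 [← hleft]; noncomm_ring
  · rw [hinv, ← hWK]
    calc K * (1 - P * W * K) = K - (1 + K * P) * W * K + W * K := by noncomm_ring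
      _ = W * K := by rw [hright]; noncomm_ring

theorem stabilizes_of_isUnimodular (hN : MatInH N) (hD : MatInH D) (hNc : MatInH Nc)
    (hDc : MatInH Dc) (hDc0 : Dc.det ≠ 0) (hD0 : D.det ≠ 0)
    (hU : IsUnimodular (Nc * N + Dc * D)) : Stabilizes (Dc⁻¹ * Nc) (N * D⁻¹) := by
  obtain ⟨e0, e1, e2, e3, e4⟩ := closedLoop_eq hDc0 hD0 hU.det_ne_zero
  have hV : MatIn ringH (Nc * N + Dc * D)⁻¹ := hU.matInH_inv
  rw [matInH_iff] at hN hD hNc hDc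
  refine ⟨e0, ?_, ?_, ?_, ?_⟩
  · rw [e1]; exact MatIn.one.sub ((hN.mul hV).mul hNc)
  · rw [e2]; exact (hN.mul hV).mul hDc
  · rw [e3]; exact (hD.mul hV).mul hNc
  · rw [e4]; exact (hD.mul hV).mul hDc

/-- `hrc` is pointwise right coprimeness. It is what excludes a zero of `det U` cancelled by common
right zeros of `N` and `D`. -/
theorem isUnimodular_of_stabilizes (hN : MatInH N) (hD : MatInH D) (hNc : MatInH Nc)
    (hDc : MatInH Dc) (hDc0 : Dc.det ≠ 0) (hD0 : D.det ≠ 0) (hcop : LeftCoprime Nc Dc)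
    (hrc : ∀ p, InRHP p → ∀ x : Fin m → ℂ, N.map (evPt p) *ᵥ x = 0 → D.map (evPt p) *ᵥ x = 0 →
      x = 0)
    (hK : Stabilizes (Dc⁻¹ * Nc) (N * D⁻¹)) : IsUnimodular (Nc * N + Dc * D) := by
  obtain ⟨k0, k1, k2, k3, k4⟩ := hK
  have hU0 : (Nc * N + Dc * D).det ≠ 0 := by
    rw [one_add_mul_eq hDc0 hD0, det_mul, det_mul]
    refine mul_ne_zero (mul_ne_zero hDc0 ?_) hD0
    rwa [det_one_add_mul_comm]
  obtain ⟨-, e1, e2, e3, e4⟩ := closedLoop_eq hDc0 hD0 hU0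
  rw [e1, matInH_iff] at k1
  rw [e2, matInH_iff] at k2
  rw [e3, matInH_iff] at k3
  rw [e4, matInH_iff] at k4
  rw [matInH_iff] at hN hD hNc hDc
  have hU : MatIn ringH (Nc * N + Dc * D) := (hNc.mul hN).add (hDc.mul hD)
  set U := Nc * N + Dc * D with hUdef
  have hUU : U⁻¹ * U = 1 := Matrix.nonsing_inv_mul _ hU0.isUnit
  obtain ⟨X, Y, hX, hY, hXY⟩ := hcop
  rw [matInH_iff] at hX hY
  -- Multiplying by the Bezout identity expresses `N U⁻¹` through the stable closed-loop matrices.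
  have hNU : MatIn ringH (N * U⁻¹) := by
    have : N * U⁻¹ = (1 - (1 - N * U⁻¹ * Nc)) * X + N * U⁻¹ * Dc * Y := by
      calc N * U⁻¹ = N * U⁻¹ * (Nc * X + Dc * Y) := by rw [hXY, mul_one]
        _ = _ := by noncomm_ring
    rw [this]
    exact ((MatIn.one.sub k1).mul hX).add (k2.mul hY)
  have hDU : MatIn ringH (D * U⁻¹) := by
    have : D * U⁻¹ = D * U⁻¹ * Nc * X + D * U⁻¹ * Dc * Y := by
      calc D * U⁻¹ = D * U⁻¹ * (Nc * X + Dc * Y) := by rw [hXY, mul_one]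
        _ = _ := by noncomm_ring
    rw [this]
    exact (k3.mul hX).add (k4.mul hY)
  refine isUnimodular_of_det_ne_zero hU fun p hp h0 => ?_
  obtain ⟨x, hx, hUx⟩ := Matrix.exists_mulVec_eq_zero_iff.2 h0
  have key : ∀ A : Matrix (Fin m) (Fin m) (RatFunc ℝ), MatIn ringH (A * U⁻¹) →
      A.map (evPt p) *ᵥ x = 0 := by
    intro A hA
    have : A = A * U⁻¹ * U := by rw [mul_assoc, hUU, mul_one]
    rw [this, (isEval_ringH hp).map_matrix_mul hA hU, ← mulVec_mulVec, hUx, mulVec_zero]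
  exact hx (hrc p hp x (key N hNU) (key D hDU))

end ClosedLoop

/-! ### The block matrix `M` and its inverse -/

section BlockMatrix

variable {m : ℕ} {N₀ N₁ D₀ D₁ : Matrix (Fin m) (Fin m) (RatFunc ℝ)}

theorem matIn_bigM {R : Subring (RatFunc ℝ)} (hN₀ : MatIn R N₀) (hN₁ : MatIn R N₁)
    (hD₀ : MatIn R D₀) (hD₁ : MatIn R D₁) : MatIn R (bigM N₀ N₁ D₀ D₁) := by
  rintro (i | i) (j | j)
  exacts [hN₀ i j, hN₁ i j, hD₀ i j, hD₁ i j]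

theorem map_bigM_mulVec (e : RatFunc ℝ → ℂ) (x y : Fin m → ℂ) :
    (bigM N₀ N₁ D₀ D₁).map e *ᵥ Sum.elim x y =
      Sum.elim (N₀.map e *ᵥ x + N₁.map e *ᵥ y) (D₀.map e *ᵥ x + D₁.map e *ᵥ y) := by
  rw [bigM, fromBlocks_map, fromBlocks_mulVec]
  rfl

theorem adjOverDet_eq_inv (B : Matrix (Fin m ⊕ Fin m) (Fin m ⊕ Fin m) (RatFunc ℝ)) :
    adjOverDet B = B⁻¹ := by
  rw [adjOverDet, Matrix.inv_def, Ring.inverse_eq_inv']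

theorem adjOverDet_mul_bigM (h : (bigM N₀ N₁ D₀ D₁).det ≠ 0) :
    (adjOverDet (bigM N₀ N₁ D₀ D₁)).toBlocks₁₁ * N₀ +
      (adjOverDet (bigM N₀ N₁ D₀ D₁)).toBlocks₁₂ * D₀ = 1 ∧
    (adjOverDet (bigM N₀ N₁ D₀ D₁)).toBlocks₁₁ * N₁ +
      (adjOverDet (bigM N₀ N₁ D₀ D₁)).toBlocks₁₂ * D₁ = 0 ∧
    (adjOverDet (bigM N₀ N₁ D₀ D₁)).toBlocks₂₁ * N₀ +
      (adjOverDet (bigM N₀ N₁ D₀ D₁)).toBlocks₂₂ * D₀ = 0 ∧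
    (adjOverDet (bigM N₀ N₁ D₀ D₁)).toBlocks₂₁ * N₁ +
      (adjOverDet (bigM N₀ N₁ D₀ D₁)).toBlocks₂₂ * D₁ = 1 := by
  have h1 := Matrix.nonsing_inv_mul _ h.isUnit
  rw [← adjOverDet_eq_inv, ← fromBlocks_toBlocks (adjOverDet (bigM N₀ N₁ D₀ D₁))] at h1
  -- The first four occurrences lie inside the blocks of the inverse; the fifth is the factor to be
  -- expanded.
  nth_rw 5 [bigM] at h1
  rw [fromBlocks_multiply, ← fromBlocks_one] at h1
  exact fromBlocks_inj.1 h1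

theorem bigM_mul_adjOverDet (h : (bigM N₀ N₁ D₀ D₁).det ≠ 0) :
    N₀ * (adjOverDet (bigM N₀ N₁ D₀ D₁)).toBlocks₁₁ +
      N₁ * (adjOverDet (bigM N₀ N₁ D₀ D₁)).toBlocks₂₁ = 1 ∧
    N₀ * (adjOverDet (bigM N₀ N₁ D₀ D₁)).toBlocks₁₂ +
      N₁ * (adjOverDet (bigM N₀ N₁ D₀ D₁)).toBlocks₂₂ = 0 ∧
    D₀ * (adjOverDet (bigM N₀ N₁ D₀ D₁)).toBlocks₁₁ +
      D₁ * (adjOverDet (bigM N₀ N₁ D₀ D₁)).toBlocks₂₁ = 0 ∧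
    D₀ * (adjOverDet (bigM N₀ N₁ D₀ D₁)).toBlocks₁₂ +
      D₁ * (adjOverDet (bigM N₀ N₁ D₀ D₁)).toBlocks₂₂ = 1 := by
  have h1 := Matrix.mul_nonsing_inv _ h.isUnit
  rw [← adjOverDet_eq_inv, ← fromBlocks_toBlocks (adjOverDet (bigM N₀ N₁ D₀ D₁))] at h1
  nth_rw 1 [bigM] at h1
  rw [fromBlocks_multiply, ← fromBlocks_one] at h1
  exact fromBlocks_inj.1 h1

theorem compensator_bezout (h : (bigM N₀ N₁ D₀ D₁).det ≠ 0)
    (F : Matrix (Fin m) (Fin m) (RatFunc ℝ)) :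
    compNum N₀ N₁ D₀ D₁ F * N₀ + compDen N₀ N₁ D₀ D₁ F * D₀ = 1 ∧
    compNum N₀ N₁ D₀ D₁ F * N₁ + compDen N₀ N₁ D₀ D₁ F * D₁ = pullback F ^ 2 := by
  obtain ⟨e1, e2, e3, e4⟩ := adjOverDet_mul_bigM h
  unfold compNum compDen
  generalize (adjOverDet (bigM N₀ N₁ D₀ D₁)).toBlocks₁₁ = a at *
  generalize (adjOverDet (bigM N₀ N₁ D₀ D₁)).toBlocks₁₂ = b at *
  generalize (adjOverDet (bigM N₀ N₁ D₀ D₁)).toBlocks₂₁ = c at *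
  generalize (adjOverDet (bigM N₀ N₁ D₀ D₁)).toBlocks₂₂ = d at *
  generalize pullback F ^ 2 = Φ
  constructor
  · calc (a + Φ * c) * N₀ + (b + Φ * d) * D₀ = (a * N₀ + b * D₀) + Φ * (c * N₀ + d * D₀) := by
          noncomm_ring
      _ = 1 := by rw [e1, e3, mul_zero, add_zero]
  · calc (a + Φ * c) * N₁ + (b + Φ * d) * D₁ = (a * N₁ + b * D₁) + Φ * (c * N₁ + d * D₁) := by
          noncomm_ring
      _ = Φ := by rw [e2, e4, mul_one, zero_add]

/-- Recovering a row of factors from its products with `M`. -/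
theorem comp_eq_of_mul_eq (h : (bigM N₀ N₁ D₀ D₁).det ≠ 0)
    {F Nc Dc T : Matrix (Fin m) (Fin m) (RatFunc ℝ)}
    (h0 : T * (Nc * N₀ + Dc * D₀) = 1) (h1 : T * (Nc * N₁ + Dc * D₁) = pullback F ^ 2) :
    compNum N₀ N₁ D₀ D₁ F = T * Nc ∧ compDen N₀ N₁ D₀ D₁ F = T * Dc := by
  obtain ⟨e1, e2, e3, e4⟩ := bigM_mul_adjOverDet h
  unfold compNum compDen
  rw [← h1]
  generalize (adjOverDet (bigM N₀ N₁ D₀ D₁)).toBlocks₁₁ = a at *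
  generalize (adjOverDet (bigM N₀ N₁ D₀ D₁)).toBlocks₁₂ = b at *
  generalize (adjOverDet (bigM N₀ N₁ D₀ D₁)).toBlocks₂₁ = c at *
  generalize (adjOverDet (bigM N₀ N₁ D₀ D₁)).toBlocks₂₂ = d at *
  constructor
  · calc a + T * (Nc * N₁ + Dc * D₁) * c
        = T * (Nc * N₀ + Dc * D₀) * a + T * (Nc * N₁ + Dc * D₁) * c := by rw [h0, one_mul]
      _ = T * (Nc * (N₀ * a + N₁ * c) + Dc * (D₀ * a + D₁ * c)) := by noncomm_ring
      _ = T * Nc := by rw [e1, e3, mul_one, mul_zero, add_zero]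
  · calc b + T * (Nc * N₁ + Dc * D₁) * d
        = T * (Nc * N₀ + Dc * D₀) * b + T * (Nc * N₁ + Dc * D₁) * d := by rw [h0, one_mul]
      _ = T * (Nc * (N₀ * b + N₁ * d) + Dc * (D₀ * b + D₁ * d)) := by noncomm_ring
      _ = T * Dc := by rw [e2, e4, mul_one, mul_zero, zero_add]

end BlockMatrix

/-! ### Cancellation of simple zeros in the closed right half-plane -/

theorem inv_mem_regularAt {w : ℂ} {f : RatFunc ℝ} (h : evalAt w f ≠ 0) : f⁻¹ ∈ regularAt w := by
  intro h0
  have hf0 : f ≠ 0 := by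
    rintro rfl
    simp [evalAt] at h
  have := zero_dvd_iff.1 (h0 ▸ map_dvd (aeval w) (RatFunc.denom_inv_dvd hf0))
  simp [evalAt_eq_div, this] at h

theorem mul_inv_mem_ringH {f d : RatFunc ℝ} (hf : f ∈ ringH) (hd : d ∈ ringH)
    (hinf : evalInfty d ≠ 0)
    (hzero : ∀ w : ℂ, 0 ≤ w.re → evalAt w d = 0 → evalAt w f = 0 ∧
      (d.num.map (algebraMap ℝ ℂ)).rootMultiplicity w = 1) : f * d⁻¹ ∈ ringH := by
  refine ⟨properRing.mul_mem hf.1 (isProper_inv hinf), fun w hw => ?_⟩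
  by_cases h : evalAt w d = 0
  · obtain ⟨h1, h2⟩ := hzero w hw h
    exact mul_inv_mem_regularAt (hd.2 w hw) h1 (hf.2 w hw) h2
  · exact (regularAt w).mul_mem (hf.2 w hw) (inv_mem_regularAt h)

/-! ### Pullbacks of Carathéodory functions -/

section Pullback

variable {m : ℕ} {F : Matrix (Fin m) (Fin m) (RatFunc ℝ)}

theorem matIn_pullback (hF : MatIn discRing F) : MatIn ringH (pullback F) :=
  fun i j => mobius_mem (hF i j)

theorem map_pullback (hF : MatIn discRing F) {p : Option ℂ} (hp : InRHP p) :
    (pullback F).map (evPt p) = F.map (evalAt (discPt p)) := by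
  ext i j
  exact evPt_mobius (hF i j) hp

theorem matIn_pullback_sq (hF : MatIn discRing F) : MatIn ringH (pullback F ^ 2) := by
  rw [sq]
  exact (matIn_pullback hF).mul (matIn_pullback hF)

theorem map_pullback_sq (hF : MatIn discRing F) {p : Option ℂ} (hp : InRHP p) :
    (pullback F ^ 2).map (evPt p) = F.map (evalAt (discPt p)) ^ 2 := by
  rw [sq, (isEval_ringH hp).map_matrix_mul (matIn_pullback hF) (matIn_pullback hF),
    map_pullback hF hp, sq]

theorem isUnimodular_segment (hF : IsCaratheodory F) {lam : ℝ} (h0 : 0 ≤ lam) (h1 : lam ≤ 1) :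
    IsUnimodular (RatFunc.C lam • pullback F ^ 2 + RatFunc.C (1 - lam) • 1) := by
  have hF' : MatIn discRing F := hF.1
  have hΦ := matIn_pullback_sq hF'
  have hone : MatIn ringH (1 : Matrix (Fin m) (Fin m) (RatFunc ℝ)) := MatIn.one
  have ha := hΦ.smul (C_mem_ringH lam)
  have hb := hone.smul (C_mem_ringH (1 - lam))
  refine isUnimodular_of_det_ne_zero (ha.add hb) fun p hp => ?_
  have hE := isEval_ringH hp
  rw [hE.map_matrix_add ha hb, hE.map_matrix_smul (C_mem_ringH _) hΦ,
    hE.map_matrix_smul (C_mem_ringH _) hone, hE.map_matrix_one, map_pullback_sq hF' hp, evPt_C,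
    evPt_C]
  exact det_segment_sq_ne_zero (hF.2 _ (norm_discPt_le hp)) h0 h1

theorem isUnimodular_pullback_sq (hF : IsCaratheodory F) : IsUnimodular (pullback F ^ 2) := by
  simpa using isUnimodular_segment hF zero_le_one le_rfl

end Pullback

/-- Multiply the real quadratics `(X - Re z_i)² + (Im z_i)²`. At a real point such a sum of squares
vanishes only if `z_i` is that point. -/
theorem exists_polynomial_vanishing {t : ℕ} (z : Fin t → ℂ) (hz : ∀ i, z i ≠ -1) :
    ∃ g : ℝ[X], (∀ i, aeval (z i) g = 0) ∧ g.eval (-1) ≠ 0 := by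
  refine ⟨∏ i, ((X - C (z i).re) ^ 2 + C ((z i).im ^ 2)), fun i => ?_, ?_⟩
  · rw [map_prod]
    refine Finset.prod_eq_zero (Finset.mem_univ i) ?_
    have h : z i - (z i).re = (z i).im * Complex.I := by
      rw [sub_eq_iff_eq_add']
      exact (Complex.re_add_im (z i)).symm
    simp [h, mul_pow]
  · rw [eval_prod, Finset.prod_ne_zero_iff]
    intro i _ h0
    simp only [eval_add, eval_pow, eval_sub, eval_X, eval_C] at h0
    have h1 := (add_eq_zero_iff_of_nonneg (sq_nonneg _) (sq_nonneg _)).1 h0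
    apply hz i
    apply Complex.ext
    · have := pow_eq_zero_iff (two_ne_zero) |>.1 h1.1
      simp
      linarith
    · simpa using h1.2

theorem discPt_some_ne {w : ℂ} (hw : 0 ≤ w.re) : discPt (some w) ≠ -1 := by
  rw [discPt, Ne, div_eq_iff (one_add_ne_zero_of_re_nonneg hw)]
  intro h
  have := congrArg Complex.re h
  simp at this
  linarith

/-! ### Stability, properness and uniqueness of the compensator -/

section Main

variable {m t : ℕ} {N₀ N₁ D₀ D₁ : Matrix (Fin m) (Fin m) (RatFunc ℝ)}

theorem bigM_det_evalInfty_ne_zero (hB : MatIn ringH (bigM N₀ N₁ D₀ D₁))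
    (hInf : ((bigM N₀ N₁ D₀ D₁).map evalInfty).det ≠ 0) :
    evalInfty (bigM N₀ N₁ D₀ D₁).det ≠ 0 := by
  rwa [isEval_properRing.map_matrix_det fun i j => (hB i j).1]

theorem bigM_det_ne_zero (hB : MatIn ringH (bigM N₀ N₁ D₀ D₁))
    (hInf : ((bigM N₀ N₁ D₀ D₁).map evalInfty).det ≠ 0) : (bigM N₀ N₁ D₀ D₁).det ≠ 0 := by
  intro h
  apply bigM_det_evalInfty_ne_zero hB hInf
  rw [h, evalInfty_zero]

theorem interp_blocks {B : Matrix (Fin m ⊕ Fin m) (Fin m ⊕ Fin m) ℂ} {A : Matrix (Fin m) (Fin m) ℂ}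
    (h : Matrix.fromCols (1 : Matrix (Fin m) (Fin m) ℂ) A * B = 0) :
    B.toBlocks₁₁ + A * B.toBlocks₂₁ = 0 ∧ B.toBlocks₁₂ + A * B.toBlocks₂₂ = 0 := by
  have key : ∀ i j, (Matrix.fromCols (1 : Matrix (Fin m) (Fin m) ℂ) A * B) i j =
      B (Sum.inl i) j + ∑ k, A i k * B (Sum.inr k) j := by
    intro i j
    simp [Matrix.mul_apply, Fintype.sum_sum_type, Matrix.one_apply]
  constructor
  · ext i j
    have := key i (Sum.inl j)
    rw [h] at this
    exact this.symm
  · ext i j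
    have := key i (Sum.inr j)
    rw [h] at this
    exact this.symm

/-- The interpolation conditions cancel the unstable poles of `(X + F₁² Y) / det M`. -/
theorem matInH_of_interp {s : Fin t → ℂ} {Mv S : Fin t → Matrix (Fin m) (Fin m) ℂ}
    {d : RatFunc ℝ} (hd : d ∈ ringH) (hinf : evalInfty d ≠ 0)
    (hs_zeros : ∀ w : ℂ, (0 ≤ w.re ∧ evalAt w d = 0) ↔ ∃ i, w = s i)
    (hs_simple : ∀ i, (d.num.map (algebraMap ℝ ℂ)).rootMultiplicity (s i) = 1)
    (hS_sq : ∀ i, S i ^ 2 = Mv i) {F : Matrix (Fin m) (Fin m) (RatFunc ℝ)}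
    (hF : SolvesInterp s S F) {Y Z : Matrix (Fin m) (Fin m) (RatFunc ℝ)} (hY : MatIn ringH Y)
    (hZ : MatIn ringH Z)
    (hYZ : ∀ i, Y.map (evalAt (s i)) + Mv i * Z.map (evalAt (s i)) = 0) :
    MatInH (d⁻¹ • Y + pullback F ^ 2 * (d⁻¹ • Z)) := by
  have hF' : MatIn discRing F := hF.1.1
  have hΦ := matIn_pullback_sq hF'
  intro i j
  have hEq : (d⁻¹ • Y + pullback F ^ 2 * (d⁻¹ • Z)) i j = (Y + pullback F ^ 2 * Z) i j * d⁻¹ := by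
    rw [Matrix.mul_smul, ← smul_add, Matrix.smul_apply, smul_eq_mul, mul_comm]
  rw [hEq]
  refine mul_inv_mem_ringH ((hY.add (hΦ.mul hZ)) i j) hd hinf fun w hw h0 => ?_
  obtain ⟨k, rfl⟩ := (hs_zeros w).1 ⟨hw, h0⟩
  refine ⟨?_, hs_simple k⟩
  have hp := inRHP_some hw
  have hE : IsEval ringH (evalAt (s k)) := isEval_ringH hp
  have h1 : (pullback F ^ 2).map (evalAt (s k)) = Mv k := by
    rw [← hS_sq, ← hF.2 k]
    exact map_pullback_sq hF' hp
  have h2 : (Y + pullback F ^ 2 * Z).map (evalAt (s k)) = 0 := by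
    rw [hE.map_matrix_add hY (hΦ.mul hZ), hE.map_matrix_mul hΦ hZ, h1, hYZ]
  exact congrFun (congrFun h2 i) j

variable {s : Fin t → ℂ} {Mv S : Fin t → Matrix (Fin m) (Fin m) ℂ}

theorem compNum_compDen_mem (hB : MatIn ringH (bigM N₀ N₁ D₀ D₁))
    (hInf : ((bigM N₀ N₁ D₀ D₁).map evalInfty).det ≠ 0)
    (hs_zeros : ∀ w : ℂ, (0 ≤ w.re ∧ evalAt w (bigM N₀ N₁ D₀ D₁).det = 0) ↔ ∃ i, w = s i)
    (hs_simple : ∀ i,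
      ((bigM N₀ N₁ D₀ D₁).det.num.map (algebraMap ℝ ℂ)).rootMultiplicity (s i) = 1)
    (hMv : ∀ i, Matrix.fromCols (1 : Matrix (Fin m) (Fin m) ℂ) (Mv i) *
      ((bigM N₀ N₁ D₀ D₁).map (evalAt (s i))).adjugate = 0)
    (hS_sq : ∀ i, S i ^ 2 = Mv i) {F : Matrix (Fin m) (Fin m) (RatFunc ℝ)}
    (hF : SolvesInterp s S F) :
    MatInH (compNum N₀ N₁ D₀ D₁ F) ∧ MatInH (compDen N₀ N₁ D₀ D₁ F) := by
  have hinf := bigM_det_evalInfty_ne_zero hB hInf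
  have hadj := hB.adjugate
  have hblocks : ∀ i, _ := fun i => interp_blocks (hMv i)
  have hmap : ∀ i, ((bigM N₀ N₁ D₀ D₁).map (evalAt (s i))).adjugate =
      (bigM N₀ N₁ D₀ D₁).adjugate.map (evalAt (s i)) := fun i =>
    ((isEval_ringH (inRHP_some ((hs_zeros (s i)).2 ⟨i, rfl⟩).1)).map_matrix_adjugate hB).symm
  simp only [hmap] at hblocks
  exact ⟨matInH_of_interp hB.det hinf hs_zeros hs_simple hS_sq hF
      (Y := (bigM N₀ N₁ D₀ D₁).adjugate.toBlocks₁₁) (Z := (bigM N₀ N₁ D₀ D₁).adjugate.toBlocks₂₁)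
      (fun i j => hadj _ _) (fun i j => hadj _ _) fun i => (hblocks i).1,
    matInH_of_interp hB.det hinf hs_zeros hs_simple hS_sq hF
      (Y := (bigM N₀ N₁ D₀ D₁).adjugate.toBlocks₁₂) (Z := (bigM N₀ N₁ D₀ D₁).adjugate.toBlocks₂₂)
      (fun i j => hadj _ _) (fun i j => hadj _ _) fun i => (hblocks i).2⟩

theorem matIn_segm {A₀ A₁ : Matrix (Fin m) (Fin m) (RatFunc ℝ)} (h₀ : MatIn ringH A₀)
    (h₁ : MatIn ringH A₁) (lam : ℝ) : MatIn ringH (segm A₀ A₁ lam) :=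
  (h₁.smul (C_mem_ringH _)).add (h₀.smul (C_mem_ringH _))

theorem solvesSimStab_compensator (hN₀ : MatInH N₀) (hN₁ : MatInH N₁) (hD₀ : MatInH D₀)
    (hD₁ : MatInH D₁) (hD : ∀ lam : ℝ, 0 ≤ lam → lam ≤ 1 → (segm D₀ D₁ lam).det ≠ 0)
    (hB0 : (bigM N₀ N₁ D₀ D₁).det ≠ 0) {F : Matrix (Fin m) (Fin m) (RatFunc ℝ)}
    (hF : IsCaratheodory F) (hNc : MatInH (compNum N₀ N₁ D₀ D₁ F))
    (hDc : MatInH (compDen N₀ N₁ D₀ D₁ F))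
    (hdet : ((compDen N₀ N₁ D₀ D₁ F).map evalInfty).det ≠ 0) :
    SolvesSimStab N₀ N₁ D₀ D₁ (compensator N₀ N₁ D₀ D₁ F) := by
  have hDcP : MatIn properRing (compDen N₀ N₁ D₀ D₁ F) := fun i j => (hDc i j).1
  have hNcP : MatIn properRing (compNum N₀ N₁ D₀ D₁ F) := fun i j => (hNc i j).1
  have hDc0 : (compDen N₀ N₁ D₀ D₁ F).det ≠ 0 := by
    intro h
    rw [← isEval_properRing.map_matrix_det hDcP, h, evalInfty_zero] at hdet
    exact hdet rfl
  refine ⟨(matProper_inv hDcP hdet).mul hNcP, fun lam h0 h1 => ?_⟩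
  refine stabilizes_of_isUnimodular (matIn_segm hN₀ hN₁ lam) (matIn_segm hD₀ hD₁ lam) hNc hDc hDc0
    (hD lam h0 h1) ?_
  obtain ⟨b0, b1⟩ := compensator_bezout hB0 F
  have : compNum N₀ N₁ D₀ D₁ F * segm N₀ N₁ lam + compDen N₀ N₁ D₀ D₁ F * segm D₀ D₁ lam =
      RatFunc.C lam • pullback F ^ 2 + RatFunc.C (1 - lam) • 1 := by
    rw [← b0, ← b1]
    simp only [segm, mul_add, Matrix.mul_smul, smul_add]
    abel
  rw [this]
  exact isUnimodular_segment hF h0 h1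

/-- The value `D_c(∞)` depends on `F` only through `A = F(-1)`, which can be moved without touching
the values at the `z_i`. -/
theorem exists_interpolant_compDen_proper (hB : MatIn ringH (bigM N₀ N₁ D₀ D₁))
    (hInf : ((bigM N₀ N₁ D₀ D₁).map evalInfty).det ≠ 0) (hs : ∀ i, 0 ≤ (s i).re)
    {F : Matrix (Fin m) (Fin m) (RatFunc ℝ)} (hF : SolvesInterp s S F) :
    ∃ F' : Matrix (Fin m) (Fin m) (RatFunc ℝ), SolvesInterp s S F' ∧
      ((compDen N₀ N₁ D₀ D₁ F').map evalInfty).det ≠ 0 := by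
  have hE := isEval_properRing
  have hBP : MatIn properRing (bigM N₀ N₁ D₀ D₁) := fun i j => (hB i j).1
  have hinv : MatIn properRing (adjOverDet (bigM N₀ N₁ D₀ D₁)) := by
    rw [adjOverDet_eq_inv]
    exact matProper_inv hBP hInf
  set m₁₂ := (adjOverDet (bigM N₀ N₁ D₀ D₁)).toBlocks₁₂ with hm₁₂
  set m₂₂ := (adjOverDet (bigM N₀ N₁ D₀ D₁)).toBlocks₂₂ with hm₂₂
  have h12 : MatIn properRing m₁₂ := fun i j => hinv _ _
  have h22 : MatIn properRing m₂₂ := fun i j => hinv _ _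
  have hD₀ : MatIn properRing D₀ := fun i j => hBP (Sum.inr i) (Sum.inl j)
  have hD₁ : MatIn properRing D₁ := fun i j => hBP (Sum.inr i) (Sum.inr j)
  have hbez : D₀.map evalInfty * m₁₂.map evalInfty + D₁.map evalInfty * m₂₂.map evalInfty = 1 := by
    rw [← hE.map_matrix_mul hD₀ h12, ← hE.map_matrix_mul hD₁ h22,
      ← hE.map_matrix_add (hD₀.mul h12) (hD₁.mul h22),
      (bigM_mul_adjOverDet (bigM_det_ne_zero hB hInf)).2.2.2, hE.map_matrix_one]
  obtain ⟨B, hBdet⟩ := exists_det_add_sq_mul_ne_zero hbez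
  obtain ⟨g, hg0, hg1⟩ := exists_polynomial_vanishing (fun i => discPt (some (s i)))
    fun i => discPt_some_ne (hs i)
  have hF' : MatIn discRing F := hF.1.1
  set A := (pullback F).map evalInfty with hA
  -- Scaled so that `G(-1) = B - A` while `G(z_i) = 0`: the perturbation `F + εG` moves along the
  -- line from `A` towards `B` at infinity.
  set G : Matrix (Fin m) (Fin m) (RatFunc ℝ) := Matrix.of fun i j =>
    algebraMap ℝ[X] (RatFunc ℝ) (g * C ((B - A) i j / g.eval (-1))) with hG
  have hGmem : MatIn discRing G := fun i j z _ => algebraMap_mem_regularAt z _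
  have hGeval : ∀ z i j, evalAt z (G i j) = aeval z g * ((B - A) i j / g.eval (-1) : ℝ) := by
    intro z i j
    rw [hG, of_apply, evalAt_algebraMap, map_mul, aeval_C]
    rfl
  have hev1 := hF.1.eventually_add_smul hGmem
  have hev2 := eventually_det_add_sq_mul_ne_zero hBdet A
  obtain ⟨ε, hε2, hε1⟩ := (hev2.and (hev1.filter_mono nhdsWithin_le_nhds)).exists
  have hCmem : RatFunc.C ε ∈ discRing := fun z _ => C_mem_regularAt z ε
  have hevF : ∀ z : ℂ, ‖z‖ ≤ 1 → ∀ i j, evalAt z ((F + RatFunc.C ε • G) i j) =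
      evalAt z (F i j) + ε * (aeval z g * ((B - A) i j / g.eval (-1) : ℝ)) := by
    intro z hz i j
    change evalAt z (F i j + RatFunc.C ε * G i j) = _
    rw [evalAt_add (hF' i j z hz) ((regularAt z).mul_mem (hCmem z hz) (hGmem i j z hz)),
      evalAt_mul (hCmem z hz) (hGmem i j z hz), evalAt_C, hGeval]
  refine ⟨F + RatFunc.C ε • G, ⟨hε1, fun k => ?_⟩, ?_⟩
  · rw [← hF.2 k]
    ext i j
    have hg := hg0 k
    simp only [map_apply]
    change evalAt (discPt (some (s k))) _ = evalAt (discPt (some (s k))) _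
    rw [hevF _ (norm_discPt_le (inRHP_some (hs k))), hg]
    simp
  · have hpull : (pullback (F + RatFunc.C ε • G)).map evalInfty = A + ε • (B - A) := by
      ext i j
      have h1 := evPt_mobius (hε1.1 i j) inRHP_none
      have h2 := evPt_mobius (hF' i j) inRHP_none
      rw [hevF _ (norm_discPt_le inRHP_none), ← h2] at h1
      have h3 : aeval (discPt none) g = ((g.eval (-1) : ℝ) : ℂ) := by
        have := aeval_algebraMap_apply ℂ (-1 : ℝ) g
        simpa [discPt] using this
      rw [h3, ← Complex.ofReal_mul, mul_div_cancel₀ _ hg1] at h1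
      simp only [evPt] at h1
      exact_mod_cast h1
    have hΨ : MatIn properRing (pullback (F + RatFunc.C ε • G)) := fun i j =>
      (matIn_pullback hε1.1 i j).1
    rw [compDen, ← hm₁₂, ← hm₂₂, sq, hE.map_matrix_add h12 ((hΨ.mul hΨ).mul h22),
      hE.map_matrix_mul (hΨ.mul hΨ) h22, hE.map_matrix_mul hΨ hΨ, hpull, ← sq]
    exact hε2

/-- Right coprimeness of `N_i, D_i` on the closed right half-plane. -/
theorem eq_zero_of_bigM_mulVec_eq_zero (hB : MatIn ringH (bigM N₀ N₁ D₀ D₁))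
    (hInf : ((bigM N₀ N₁ D₀ D₁).map evalInfty).det ≠ 0)
    (hs_zeros : ∀ w : ℂ, (0 ≤ w.re ∧ evalAt w (bigM N₀ N₁ D₀ D₁).det = 0) ↔ ∃ i, w = s i)
    (hs_simple : ∀ i,
      ((bigM N₀ N₁ D₀ D₁).det.num.map (algebraMap ℝ ℂ)).rootMultiplicity (s i) = 1)
    (hMv : ∀ i, Matrix.fromCols (1 : Matrix (Fin m) (Fin m) ℂ) (Mv i) *
      ((bigM N₀ N₁ D₀ D₁).map (evalAt (s i))).adjugate = 0)
    {p : Option ℂ} (hp : InRHP p) {x y : Fin m → ℂ}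
    (hxy : (bigM N₀ N₁ D₀ D₁).map (evPt p) *ᵥ Sum.elim x y = 0) :
    (x = 0 ∧ y = 0) ∨ ∃ i, x + Mv i *ᵥ y = 0 := by
  by_cases hdet : evPt p (bigM N₀ N₁ D₀ D₁).det = 0
  · right
    cases p with
    | none =>
      refine absurd hdet ?_
      simpa [evPt] using bigM_det_evalInfty_ne_zero hB hInf
    | some w =>
      obtain ⟨k, rfl⟩ := (hs_zeros w).1 ⟨hp w rfl, hdet⟩
      refine ⟨k, ?_⟩
      have hBw : MatIn (regularAt (s k)) (bigM N₀ N₁ D₀ D₁) := fun i j => (hB i j).2 _ (hp _ rfl)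
      ext i
      have hr : (Matrix.fromCols (1 : Matrix (Fin m) (Fin m) ℂ) (Mv k)) i ᵥ*
          ((bigM N₀ N₁ D₀ D₁).map (evalAt (s k))).adjugate = 0 := by
        ext j
        exact congrFun (congrFun (hMv k) i) j
      have := dotProduct_eq_zero_of_simple_zero hBw (hs_simple k) hr hxy
      have h2 : (Matrix.fromCols (1 : Matrix (Fin m) (Fin m) ℂ) (Mv k) *ᵥ Sum.elim x y) i = 0 :=
        this
      simpa [fromCols_mulVec] using h2
  · left
    rw [(isEval_ringH hp).map_matrix_det hB] at hdet
    have h0 : Sum.elim x y = 0 := by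
      by_contra hne
      exact hdet (Matrix.exists_mulVec_eq_zero_iff.1 ⟨_, hne, hxy⟩)
    exact ⟨funext fun i => congrFun h0 (Sum.inl i), funext fun i => congrFun h0 (Sum.inr i)⟩

/-- Normalizing `Δ₀` to the identity multiplies both factors on the left by `Δ₀⁻¹`, which cancels in
`D_c⁻¹ N_c`. -/
theorem eq_compensator {Nc Dc F : Matrix (Fin m) (Fin m) (RatFunc ℝ)}
    (hB0 : (bigM N₀ N₁ D₀ D₁).det ≠ 0) (hΔ : (Nc * N₀ + Dc * D₀).det ≠ 0)
    (hF : (Nc * N₀ + Dc * D₀)⁻¹ * (Nc * N₁ + Dc * D₁) = pullback F ^ 2) :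
    Dc⁻¹ * Nc = compensator N₀ N₁ D₀ D₁ F := by
  obtain ⟨e1, e2⟩ := comp_eq_of_mul_eq hB0 (Matrix.nonsing_inv_mul _ hΔ.isUnit) hF
  rw [compensator, e1, e2, Matrix.mul_inv_rev, Matrix.nonsing_inv_nonsing_inv _ hΔ.isUnit,
    mul_assoc, ← mul_assoc _ _ Nc, Matrix.mul_nonsing_inv _ hΔ.isUnit, one_mul]

end Main

end SimStab

theorem proposition3 (m t : ℕ)
    (N₀ N₁ D₀ D₁ : Matrix (Fin m) (Fin m) (RatFunc ℝ))
    (hN₀ : MatInH N₀) (hN₁ : MatInH N₁) (hD₀ : MatInH D₀) (hD₁ : MatInH D₁)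
    -- the plants `P_lam = N_lam D_lam⁻¹` exist
    (hD : ∀ lam : ℝ, 0 ≤ lam → lam ≤ 1 → (segm D₀ D₁ lam).det ≠ 0)
    -- `det M(∞) ≠ 0`, and the zeros of `det M` in the closed right half-plane are `s_i`, all simple
    (hInf : ((bigM N₀ N₁ D₀ D₁).map evalInfty).det ≠ 0)
    (s : Fin t → ℂ) (hs_inj : Function.Injective s)
    (hs_zeros : ∀ w : ℂ, (0 ≤ w.re ∧ evalAt w (bigM N₀ N₁ D₀ D₁).det = 0) ↔ ∃ i, w = s i)
    (hs_simple : ∀ i,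
      ((bigM N₀ N₁ D₀ D₁).det.num.map (algebraMap ℝ ℂ)).rootMultiplicity (s i) = 1)
    -- the interpolation values: `[Δ₀(s_i) Δ₁(s_i)] Adj M(s_i) = 0` when `Δ₀(s_i)⁻¹ Δ₁(s_i) = M_i`
    (Mv : Fin t → Matrix (Fin m) (Fin m) ℂ)
    (hMv : ∀ i, Matrix.fromCols (1 : Matrix (Fin m) (Fin m) ℂ) (Mv i) *
      ((bigM N₀ N₁ D₀ D₁).map (evalAt (s i))).adjugate = 0)
    -- `S_i = M_i^{1/2}`, with positive definite Hermitian part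
    (S : Fin t → Matrix (Fin m) (Fin m) ℂ)
    (hS_sq : ∀ i, S i ^ 2 = Mv i)
    (hS_pos : ∀ i, (S i + (S i).conjTranspose).PosDef) :
    -- every interpolant `F` yields a compensator
    (∀ F : Matrix (Fin m) (Fin m) (RatFunc ℝ), SolvesInterp s S F →
      MatInH (compNum N₀ N₁ D₀ D₁ F) ∧ MatInH (compDen N₀ N₁ D₀ D₁ F) ∧
      compNum N₀ N₁ D₀ D₁ F * N₀ + compDen N₀ N₁ D₀ D₁ F * D₀ = 1 ∧
      compNum N₀ N₁ D₀ D₁ F * N₁ + compDen N₀ N₁ D₀ D₁ F * D₁ = pullback F ^ 2 ∧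
      IsUnimodular (pullback F ^ 2) ∧
      (((compDen N₀ N₁ D₀ D₁ F).map evalInfty).det ≠ 0 →
        SolvesSimStab N₀ N₁ D₀ D₁ (compensator N₀ N₁ D₀ D₁ F))) ∧
    -- if an interpolant exists, then the simultaneous stabilization problem is solvable
    ((∃ F : Matrix (Fin m) (Fin m) (RatFunc ℝ), SolvesInterp s S F) →
      ∃ F : Matrix (Fin m) (Fin m) (RatFunc ℝ), SolvesInterp s S F ∧
        ((compDen N₀ N₁ D₀ D₁ F).map evalInfty).det ≠ 0 ∧
        SolvesSimStab N₀ N₁ D₀ D₁ (compensator N₀ N₁ D₀ D₁ F)) ∧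
    -- conversely, a solution `K = D_c⁻¹ N_c` has unimodular `Δ₀, Δ₁`, and if `Δ₀⁻¹ Δ₁` takes the
    -- values `M_i` and is the square of the pullback of a Carathéodory function `F`, then `F` is an
    -- interpolant and `K` is the compensator given by `F`
    (∀ Nc Dc : Matrix (Fin m) (Fin m) (RatFunc ℝ), MatInH Nc → MatInH Dc → LeftCoprime Nc Dc →
      Dc.det ≠ 0 → SolvesSimStab N₀ N₁ D₀ D₁ (Dc⁻¹ * Nc) →
      IsUnimodular (Nc * N₀ + Dc * D₀) ∧ IsUnimodular (Nc * N₁ + Dc * D₁) ∧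
      ∀ F : Matrix (Fin m) (Fin m) (RatFunc ℝ), IsCaratheodory F →
        (Nc * N₀ + Dc * D₀)⁻¹ * (Nc * N₁ + Dc * D₁) = pullback F ^ 2 →
        (∀ i, ((Nc * N₀ + Dc * D₀).map (evalAt (s i)))⁻¹ *
          (Nc * N₁ + Dc * D₁).map (evalAt (s i)) = Mv i) →
        SolvesInterp s S F ∧ Dc⁻¹ * Nc = compensator N₀ N₁ D₀ D₁ F) := by

  have hB : MatIn ringH (bigM N₀ N₁ D₀ D₁) := matIn_bigM hN₀ hN₁ hD₀ hD₁
  have hB0 := bigM_det_ne_zero hB hInf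
  have hs : ∀ i, 0 ≤ (s i).re := fun i => ((hs_zeros (s i)).2 ⟨i, rfl⟩).1
  have hmem : ∀ F, SolvesInterp s S F → _ := fun F hF =>
    compNum_compDen_mem hB hInf hs_zeros hs_simple hMv hS_sq hF
  have hsolve : ∀ F, SolvesInterp s S F → _ := fun F hF =>
    solvesSimStab_compensator hN₀ hN₁ hD₀ hD₁ hD hB0 hF.1 (hmem F hF).1 (hmem F hF).2
  refine ⟨fun F hF => ⟨(hmem F hF).1, (hmem F hF).2, (compensator_bezout hB0 F).1,
    (compensator_bezout hB0 F).2, isUnimodular_pullback_sq hF.1, hsolve F hF⟩, ?_, ?_⟩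
  · rintro ⟨F, hF⟩
    obtain ⟨F', hF', hdet⟩ := exists_interpolant_compDen_proper hB hInf hs hF
    exact ⟨F', hF', hdet, hsolve F' hF' hdet⟩
  · intro Nc Dc hNc hDc hcop hDc0 hK
    have hcoprime := fun p (hp : InRHP p) x y =>
      eq_zero_of_bigM_mulVec_eq_zero hB hInf hs_zeros hs_simple hMv hp (x := x) (y := y)
    -- Only the endpoint plants `P₀` and `P₁` enter the converse.
    have hst0 := hK.2 0 le_rfl zero_le_one
    have hst1 := hK.2 1 zero_le_one le_rfl
    have hd0 := hD 0 le_rfl zero_le_one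
    have hd1 := hD 1 zero_le_one le_rfl
    simp only [plant, segm, map_zero, map_one, sub_zero, sub_self, zero_smul, one_smul, zero_add,
      add_zero] at hst0 hst1 hd0 hd1
    have hΔ0 : IsUnimodular (Nc * N₀ + Dc * D₀) := by
      refine isUnimodular_of_stabilizes hN₀ hD₀ hNc hDc hDc0 hd0 hcop (fun p hp x h1 h2 => ?_) hst0
      -- A common null vector `x` of `N₀(p)` and `D₀(p)` gives the null vector `(x, 0)` of `M(p)`,
      -- and `[I M_i]` sends it to `x`.
      rcases hcoprime p hp x 0 (by
        rw [map_bigM_mulVec, h1, h2]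
        ext (i | i) <;> simp) with h | ⟨i, h⟩
      · exact h.1
      · simpa using h
    have hΔ1 : IsUnimodular (Nc * N₁ + Dc * D₁) := by
      refine isUnimodular_of_stabilizes hN₁ hD₁ hNc hDc hDc0 hd1 hcop (fun p hp y h1 h2 => ?_) hst1
      rcases hcoprime p hp 0 y (by
        rw [map_bigM_mulVec, h1, h2]
        ext (i | i) <;> simp) with h | ⟨i, h⟩
      · exact h.2
      -- For `(0, y)` the relation is only `M_i y = 0`, so invertibility of `M_i = S_i²` is needed.
      · have hdet : (Mv i).det ≠ 0 := by
          rw [← hS_sq, Matrix.det_pow]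
          exact pow_ne_zero _ (det_ne_zero_of_posDef_add_conjTranspose (hS_pos i))
        by_contra hy
        exact hdet (Matrix.exists_mulVec_eq_zero_iff.1 ⟨y, hy, by simpa using h⟩)
    refine ⟨hΔ0, hΔ1, fun F hF hΦ hval => ⟨⟨hF, fun i => ?_⟩, eq_compensator hB0 hΔ0.det_ne_zero hΦ⟩⟩
    have hp := inRHP_some (hs i)
    have hE : IsEval ringH (evalAt (s i)) := isEval_ringH hp
    -- The hypotheses give `F(z_i)² = M_i = S_i²`, and both roots have positive definite Hermitian
    -- part.
    refine eq_of_sq_eq_sq_of_posDef (hF.2 _ (norm_discPt_le hp)) (hS_pos i) ?_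
    rw [hS_sq, ← hval i]
    have hΦ' : (Nc * N₁ + Dc * D₁) = (Nc * N₀ + Dc * D₀) * pullback F ^ 2 := by
      rw [← hΦ, ← mul_assoc, Matrix.mul_nonsing_inv _ hΔ0.det_ne_zero.isUnit, one_mul]
    have hdet : ((Nc * N₀ + Dc * D₀).map (evalAt (s i))).det ≠ 0 := by
      have h0 : MatIn ringH (Nc * N₀ + Dc * D₀) := hΔ0.1
      rw [← hE.map_matrix_det h0]
      exact hΔ0.2.evPt_ne_zero hp
    rw [hΦ', hE.map_matrix_mul hΔ0.1 (matIn_pullback_sq hF.1), ← mul_assoc,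
      Matrix.nonsing_inv_mul _ hdet.isUnit, one_mul]
    exact (map_pullback_sq hF.1 hp).symm
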